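/- Let $|LCS(x;y)|$ be the length of the longest common subsequences of two finite strings. For $k\ge 1$ let $(X_i')_{i\ge1}$, $(Y_i')_{i\ge1}$ be independent iid sequences, uniform on $k$ letters. Put $\gamma_k^*=\lim_n \frac1n\,\mathbb E|LCS(X_1'\cdots X_n';Y_1'\cdots Y_n')|$ and, for $p\in(-1,1)$, $\gamma_k(p)=\lim_n \frac1n\,\mathbb E|LCS(X_1'\cdots X'_{n-np};Y_1'\cdots Y'_{n+np})|$ (indices rounded to the nearest positive integer). Let $p_M$ be the largest point of $(-1,1)$ at which $\gamma_2$ is maximal. Let $\frac12<\alpha<\beta<1$. For $d\ge1$ let $\ell$ be the positive even integer nearest to $d^\beta$ (the larger one in case of a tie). Let $X=X_1\cdots X_{2d}$ and $Y=Y_1\cdots Y_{2d}$ be independent random strings over a two-letter alphabet such that $Y$ is iid uniform, $X_{d-\ell/2+1}=\dots=X_{d+\ell/2}$ almost surely (the long constant block), and the letters of $X$ outside the block are iid uniform. Let $X^*$ be obtained from $X$ by replacing the block by fresh iid uniform symbols, which are independent of $X$ and $Y$. An alignment of $X$ and $Y$ is a set of non-crossing pairs of positions that carry equal letters, each position being used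 at most once; the unpaired positions are aligned with gaps; the alignment is optimal if its number of pairs is maximal. Assume that $2\gamma_2^*<2$ and that $\gamma_2$ is differentiable at $p_M$. (1) There is a constant $C_G>0$, independent of $d$, such that for all $d\ge1$ each of the following two events has probability at least $1-e^{-C_G d^{2\alpha-1}}$: (a) every optimal alignment of $X$ and $Y$ aligns at most $d^\alpha$ symbols of the long block with gaps; (b) leaving out the first $\lfloor d^\alpha\rfloor$ symbols of the long block strictly decreases the LCS, that is, $|LCS(X;Y)|>|LCS(X_1\cdots X_{d-\ell/2}X_{d-\ell/2+\lfloor d^\alpha\rfloor+1}\cdots X_{2d};Y)|$. (2) For every constant $\tilde c_H$ with $0<\tilde c_H<\frac{3\gamma_2^*}{2}-1$ there is a constant $C_H>0$, independent of $d$, such that for all $d\ge1$ $$\mathbb P\left(|LCS(X^*;Y)|-|LCS(X;Y)|\ge \tilde c_H d^\beta\right)\ge 1-e^{-C_H d^{2\alpha-1}}.$$ -/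

import Mathlib

open MeasureTheory ProbabilityTheory Filter Topology

noncomputable section

/-- Length of the longest common subsequences of two finite strings. The set is never empty
(it contains `0`) and is bounded by the length of `x`. -/
def lcs {A : Type*} (x y : List A) : ℕ :=
  sSup {n : ℕ | ∃ z : List A, z.Sublist x ∧ z.Sublist y ∧ z.length = n}

/-- Length of the longest common subsequences of two strings given as indexed families. -/
def lcsFn {A : Type*} {n m : ℕ} (x : Fin n → A) (y : Fin m → A) : ℕ :=
  lcs (List.ofFn x) (List.ofFn y)

/-- `𝔼 |LCS(X₁ … X_a ; Y₁ … Y_b)|` for two independent strings of iid letters, uniform on an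
alphabet with `k` letters: the average over all pairs of words. -/
def meanLCS (k a b : ℕ) : ℝ :=
  (∑ x : Fin a → Fin k, ∑ y : Fin b → Fin k, (lcsFn x y : ℝ)) / (k : ℝ) ^ (a + b)

/-- The constant `γ*_k = lim 𝔼 LC_n / n`. -/
def gammaStar (k : ℕ) : ℝ :=
  limUnder atTop (fun n : ℕ => meanLCS k n n / (n : ℝ))

/-- The positive integer nearest to a real number. -/
def nearestPos (x : ℝ) : ℕ := max 1 (round x).toNat

/-- `γ_k(n, p) = 𝔼 |LCS(X₁ … X_{n - np} ; Y₁ … Y_{n + np})| / n`. -/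
def gammaFin (k n : ℕ) (p : ℝ) : ℝ :=
  meanLCS k (nearestPos ((n : ℝ) - n * p)) (nearestPos ((n : ℝ) + n * p)) / (n : ℝ)

/-- The mean LCS-function `γ_k(p) = lim γ_k(n, p)`, meaningful for `p ∈ (-1, 1)`. -/
def gammaFun (k : ℕ) (p : ℝ) : ℝ :=
  limUnder atTop (fun n : ℕ => gammaFin k n p)

/-- `p_M`, the largest point of `(-1, 1)` at which `γ_k` is maximal. -/
def pMax (k : ℕ) : ℝ :=
  sSup {p : ℝ | p ∈ Set.Ioo (-1 : ℝ) 1 ∧ IsMaxOn (gammaFun k) (Set.Ioo (-1 : ℝ) 1) p}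

/-- The length of the long block: the positive even integer nearest to `d ^ β`. -/
def blockLen (β : ℝ) (d : ℕ) : ℕ := 2 * nearestPos ((d : ℝ) ^ β / 2)

/-- The (zero-based) positions `d - ℓ/2, …, d + ℓ/2 - 1` of the long block. -/
def block (d ℓ : ℕ) : Finset (Fin (2 * d)) :=
  Finset.univ.filter (fun i => d - ℓ / 2 ≤ (i : ℕ) ∧ (i : ℕ) < d + ℓ / 2)

/-- The model with one inserted long constant block of length `ℓ` in the middle of a string of
length `2 * d` over an alphabet with `k` letters. `X` is the string with the block, `Xs` is the
string obtained from `X` by replacing the block by fresh iid symbols, and `Y` is the other string.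
The letter of the block may be random, and may depend on the letters of `X` outside the block. -/
structure LongBlockModel {Ω : Type*} [MeasurableSpace Ω] (P : Measure Ω) (k d ℓ : ℕ)
    (X Xs Y : Fin (2 * d) → Ω → Fin k) : Prop where
  measurable_X : ∀ i, Measurable (X i)
  measurable_Xs : ∀ i, Measurable (Xs i)
  measurable_Y : ∀ i, Measurable (Y i)
  /-- `X` is almost surely constant on the block. -/
  const : ∀ᵐ ω ∂P, ∀ i ∈ block d ℓ, ∀ j ∈ block d ℓ, X i ω = X j ω
  /-- The two strings `X` and `Xs` agree outside the block. -/
  agree : ∀ᵐ ω ∂P, ∀ i, i ∉ block d ℓ → Xs i ω = X i ω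
  /-- All the letters of `Xs` and `Y` are independent … -/
  indep : iIndepFun (Sum.elim Xs Y) P
  /-- … and uniformly distributed. -/
  unif_Xs : ∀ i a, P.real {ω | Xs i ω = a} = 1 / (k : ℝ)
  unif_Y : ∀ i a, P.real {ω | Y i ω = a} = 1 / (k : ℝ)
  /-- `X` is independent of `Y` and of the fresh symbols put in the place of the block. -/
  fresh : IndepFun (fun ω (i : Fin (2 * d)) => X i ω)
    (fun ω => ((fun i : {i // i ∈ block d ℓ} => Xs i.1 ω), fun j : Fin (2 * d) => Y j ω)) P

/-- An alignment of two strings: a set of aligned pairs of positions that carry the same letter,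
without crossings and with every position used at most once. The positions that are in no pair
are aligned with gaps. Its score is its number of pairs. -/
def IsAlignment {A : Type*} {n m : ℕ} (x : Fin n → A) (y : Fin m → A)
    (π : Finset (Fin n × Fin m)) : Prop :=
  (∀ p ∈ π, x p.1 = y p.2) ∧ ∀ p ∈ π, ∀ q ∈ π, (p.1 < q.1 ↔ p.2 < q.2) ∧ (p.1 = q.1 ↔ p.2 = q.2)

/-- An alignment of maximal score. -/
def IsOptimalAlignment {A : Type*} {n m : ℕ} (x : Fin n → A) (y : Fin m → A)
    (π : Finset (Fin n × Fin m)) : Prop :=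
  IsAlignment x y π ∧ ∀ π' : Finset (Fin n × Fin m), IsAlignment x y π' → π'.card ≤ π.card

/-- The number of positions of `s` (in the first string) which `π` aligns with gaps. -/
def gapCount {n m : ℕ} (s : Finset (Fin n)) (π : Finset (Fin n × Fin m)) : ℕ :=
  (s \ π.image Prod.fst).card

/-- The string `x` from which the first `m` symbols of the block of length `ℓ` are left out. -/
def cutBlock {A : Type*} {d : ℕ} (ℓ m : ℕ) (x : Fin (2 * d) → A) : List A :=
  (List.ofFn x).take (d - ℓ / 2) ++ (List.ofFn x).drop (d - ℓ / 2 + m)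

/-- Every optimal alignment aligns at most `d ^ α` symbols of the long block with gaps. -/
def eventGaps {Ω : Type*} {k d : ℕ} (α : ℝ) (ℓ : ℕ) (X Y : Fin (2 * d) → Ω → Fin k) : Set Ω :=
  {ω | ∀ π : Finset (Fin (2 * d) × Fin (2 * d)),
    IsOptimalAlignment (fun i => X i ω) (fun i => Y i ω) π →
      (gapCount (block d ℓ) π : ℝ) ≤ (d : ℝ) ^ α}

/-- The event `G^d`: leaving out `⌊d ^ α⌋` symbols of the long block decreases the LCS.
(Rounding down gives the smallest event among the possible roundings of `d ^ α`.) -/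
def eventG {Ω : Type*} {k d : ℕ} (α : ℝ) (ℓ : ℕ) (X Y : Fin (2 * d) → Ω → Fin k) : Set Ω :=
  {ω | lcs (cutBlock ℓ ⌊(d : ℝ) ^ α⌋₊ (fun i => X i ω)) (List.ofFn (fun i => Y i ω)) <
    lcsFn (fun i => X i ω) (fun i => Y i ω)}

/-- The event `H^d`: replacing the long block by iid symbols increases the LCS by at least
`c * d ^ β`. -/
def eventH {Ω : Type*} {k d : ℕ} (β c : ℝ) (X Xs Y : Fin (2 * d) → Ω → Fin k) : Set Ω :=
  {ω | c * (d : ℝ) ^ β ≤ (lcsFn (fun i => Xs i ω) (fun i => Y i ω) : ℝ) -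
    (lcsFn (fun i => X i ω) (fun i => Y i ω) : ℝ)}

end

/-!
The proof compares strings with the limiting mean LCS. Write `ecs m n` for the mean LCS of two
independent uniform words of lengths `m` and `n`, and `limLCS m n = lim ecs (k m) (k n) / k`. The
latter is superadditive and homogeneous, so that `ecs m n ≤ limLCS m n ≤ γ* (m + n) / 2`
(`limLCS_le`): equal lengths are best.

Write `X = w₁ aˡ w₂` with `l` the length of the block. An alignment with `Y` cuts `Y` into
`y₁ y₂ y₃`, and the LCS is the maximum of `lcs w₁ y₁ + min l (count a y₂) + lcs w₂ y₃`
(`exists_fillBlock_eq`, `fillBlock_ge`). With `d` the half length of the strings, all these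
quantities are within a small multiple of `d ^ α` of their means, with the probability that is
claimed, by McDiarmid's inequality (`wordProb_abs_sub_le`, `wordProb_not_typical_le`).

* Suppose that at most `l - m` letters of the block are matched, `m = ⌊d ^ α⌋`. Then `y₂` has
  little more than `2 (l - m)` letters, so that `y₁` or `y₃` is not much shorter than its partner.
  Moving `2 m` letters from that side to `y₂` gains about `m` pairs and costs about `γ* m < m`
  pairs (`Typical.lcs_fillBlock_lt`), hence shortening the block by `m` letters decreases the LCS.
  Since the block is constant, an alignment that leaves `m` of its letters unmatched would survive
  this shortening (`gapCount_le_of_lcs_cutBlock_lt`), which gives the bound on the gaps.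
* With the block, the LCS is at most about `2 d γ* - 3 γ* l / 2 + l`, since the block uses up `2 l`
  letters of `Y`; with random letters it is about `2 d γ*` (`Typical.lcs_sub_ge`).

The cost of moving letters rests on two facts. First, the mean LCS function loses only `o(δ)` at
some points `δ > 0` (`exists_gammaFun_ge`; this is where differentiability at `p_M` enters), and by
superadditivity this bounds the slope of `limLCS` whenever the second word is not much shorter than
the first (`limLCS_sub_le`). Second, `limLCS m n - ecs m n` is `O((m + n) ^ θ)` for every `θ > 1/2`
(`exists_rate`), hence negligible against `d ^ α`. For the second fact, a linear function that
dominates `ecs` at total length `N` dominates it at all multiples of `N` up to an error of order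
`√N log N` per piece (`ecs_le_linear`); a supporting line of `ecs` at the scale `N` touches at two
pairs of lengths, from which words of any ratio in between are assembled, with a remainder that is
treated recursively (`limLCS_le_ecs_add`).

For short strings the events only need a positive probability, which comes from exhibiting one
favourable configuration for each letter of the block (`LongBlockModel.le_real`).
-/

noncomputable section

/-! ### Longest common subsequences -/

section LCS

variable {A : Type*}

theorem lcs_bddAbove (x y : List A) :
    BddAbove {n : ℕ | ∃ z : List A, z.Sublist x ∧ z.Sublist y ∧ z.length = n} := by
  refine ⟨x.length, ?_⟩
  rintro n ⟨z, hx, -, rfl⟩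
  exact hx.length_le

theorem exists_length_eq_lcs (x y : List A) :
    ∃ z : List A, z.Sublist x ∧ z.Sublist y ∧ z.length = lcs x y :=
  Nat.sSup_mem (s := {n : ℕ | ∃ z : List A, z.Sublist x ∧ z.Sublist y ∧ z.length = n})
    ⟨0, [], List.nil_sublist _, List.nil_sublist _, rfl⟩ (lcs_bddAbove x y)

theorem length_le_lcs {x y z : List A} (hx : z.Sublist x) (hy : z.Sublist y) :
    z.length ≤ lcs x y :=
  le_csSup (lcs_bddAbove x y) ⟨z, hx, hy, rfl⟩

theorem lcs_mono {x x' y y' : List A} (hx : x.Sublist x') (hy : y.Sublist y') :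
    lcs x y ≤ lcs x' y' := by
  obtain ⟨z, h1, h2, h3⟩ := exists_length_eq_lcs x y
  rw [← h3]
  exact length_le_lcs (h1.trans hx) (h2.trans hy)

theorem lcs_comm (x y : List A) : lcs x y = lcs y x := by
  unfold lcs
  congr 1
  ext n
  exact ⟨fun ⟨z, h1, h2, h3⟩ => ⟨z, h2, h1, h3⟩, fun ⟨z, h1, h2, h3⟩ => ⟨z, h2, h1, h3⟩⟩

theorem lcs_le_length_left (x y : List A) : lcs x y ≤ x.length := by
  obtain ⟨z, h1, h2, h3⟩ := exists_length_eq_lcs x y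
  rw [← h3]
  exact h1.length_le

theorem lcs_self (x : List A) : lcs x x = x.length :=
  le_antisymm (lcs_le_length_left x x) (length_le_lcs (List.Sublist.refl x) (List.Sublist.refl x))

theorem lcs_append_le (x y x' y' : List A) :
    lcs x y + lcs x' y' ≤ lcs (x ++ x') (y ++ y') := by
  obtain ⟨z, h1, h2, h3⟩ := exists_length_eq_lcs x y
  obtain ⟨z', h1', h2', h3'⟩ := exists_length_eq_lcs x' y'
  rw [← h3, ← h3', ← List.length_append]
  exact length_le_lcs (h1.append h1') (h2.append h2')

/-- A cut of the first string can be completed to a cut of both strings without loss. -/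
theorem exists_lcs_append (x x' y : List A) :
    ∃ y₁ y₂, y = y₁ ++ y₂ ∧ lcs (x ++ x') y = lcs x y₁ + lcs x' y₂ := by
  obtain ⟨z, h1, h2, h3⟩ := exists_length_eq_lcs (x ++ x') y
  obtain ⟨z₁, z₂, rfl, hz₁, hz₂⟩ := List.sublist_append_iff.1 h1
  obtain ⟨y₁, y₂, rfl, hy₁, hy₂⟩ := List.append_sublist_iff.1 h2
  refine ⟨y₁, y₂, rfl, le_antisymm ?_ (lcs_append_le x y₁ x' y₂)⟩
  rw [← h3, List.length_append]
  exact add_le_add (length_le_lcs hz₁ hy₁) (length_le_lcs hz₂ hy₂)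

theorem lcs_insert_le (u v y : List A) (a : A) :
    lcs (u ++ a :: v) y ≤ lcs (u ++ v) y + 1 := by
  obtain ⟨y₁, y₂, rfl, h⟩ := exists_lcs_append u (a :: v) y
  obtain ⟨y₃, y₄, rfl, h'⟩ := exists_lcs_append [a] v y₂
  have h1 := lcs_le_length_left [a] y₃
  have h2 := lcs_append_le u y₁ v y₄
  have h3 : lcs (u ++ v) (y₁ ++ y₄) ≤ lcs (u ++ v) (y₁ ++ (y₃ ++ y₄)) :=
    lcs_mono (List.Sublist.refl _)
      ((List.Sublist.refl _).append (List.sublist_append_right _ _))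
  simp only [List.length_singleton, List.singleton_append] at h1 h'
  omega

theorem lcs_append_le_add_length (x x' y : List A) :
    lcs (x ++ x') y ≤ lcs x y + x'.length := by
  obtain ⟨y₁, y₂, rfl, h⟩ := exists_lcs_append x x' y
  have h1 := lcs_le_length_left x' y₂
  have h2 : lcs x y₁ ≤ lcs x (y₁ ++ y₂) :=
    lcs_mono (List.Sublist.refl _) (List.sublist_append_left _ _)
  omega

/-- Two strings can be cut after a total of `N` symbols at the cost of at most one pair. -/
theorem exists_cut (x y : List A) (N : ℕ) (hN : N ≤ x.length + y.length) :
    ∃ x₁ x₂ y₁ y₂, x = x₁ ++ x₂ ∧ y = y₁ ++ y₂ ∧ x₁.length + y₁.length = N ∧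
      lcs x y ≤ lcs x₁ y₁ + lcs x₂ y₂ + 1 := by
  induction x generalizing y N with
  | nil =>
    refine ⟨[], [], y.take N, y.drop N, rfl, (List.take_append_drop N y).symm, ?_, ?_⟩
    · simp at hN ⊢
      exact hN
    · have := lcs_le_length_left ([] : List A) y
      simp only [List.length_nil] at this
      omega
  | cons c x ih =>
    obtain ⟨y₁, y₂, rfl, h⟩ := exists_lcs_append [c] x y
    have h1 := lcs_le_length_left [c] y₁
    simp only [List.length_singleton, List.singleton_append] at h h1
    rcases le_or_gt N y₁.length with hle | hgt
    · refine ⟨[], c :: x, y₁.take N, y₁.drop N ++ y₂, rfl, ?_, ?_, ?_⟩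
      · rw [← List.append_assoc, List.take_append_drop]
      · simpa using hle
      · have h2 : lcs x y₂ ≤ lcs (c :: x) (y₁.drop N ++ y₂) :=
          lcs_mono (List.sublist_cons_self _ _) (List.sublist_append_right _ _)
        omega
    · simp only [List.length_cons, List.length_append] at hN
      obtain ⟨x₁, x₂, y₃, y₄, rfl, rfl, hlen, hl⟩ := ih y₂ (N - 1 - y₁.length) (by omega)
      refine ⟨c :: x₁, x₂, y₁ ++ y₃, y₄, rfl, by simp, ?_, ?_⟩
      · simp only [List.length_cons, List.length_append]
        omega
      · have h2 := lcs_append_le [c] y₁ x₁ y₃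
        simp only [List.singleton_append] at h2
        omega

theorem lcs_replicate [DecidableEq A] (n : ℕ) (a : A) (y : List A) :
    lcs (List.replicate n a) y = min n (y.count a) := by
  apply le_antisymm
  · obtain ⟨z, h1, h2, h3⟩ := exists_length_eq_lcs (List.replicate n a) y
    obtain ⟨k, hk, rfl⟩ := List.sublist_replicate_iff.1 h1
    rw [← h3, List.length_replicate]
    exact le_min hk (List.replicate_sublist_iff.1 h2)
  · have h1 : (List.replicate (min n (y.count a)) a).Sublist (List.replicate n a) :=
      List.replicate_sublist_replicate a |>.2 (min_le_left _ _)
    have h2 : (List.replicate (min n (y.count a)) a).Sublist y :=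
      List.replicate_sublist_iff.2 (min_le_right _ _)
    simpa using length_le_lcs h1 h2

end LCS

/-! ### Averages over binary words -/

/-- The mean of `g` over all binary words of length `n`, by recursion on the first letter. -/
def avg : ℕ → (List (Fin 2) → ℝ) → ℝ
  | 0, g => g []
  | n + 1, g => (avg n (fun u => g (0 :: u)) + avg n (fun u => g (1 :: u))) / 2

theorem avg_mono {n : ℕ} {g h : List (Fin 2) → ℝ} (H : ∀ u, u.length = n → g u ≤ h u) :
    avg n g ≤ avg n h := by
  induction n generalizing g h with
  | zero => exact H [] rfl
  | succ n ih =>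
    have h0 := ih (g := fun u => g (0 :: u)) (h := fun u => h (0 :: u))
      fun u hu => H _ (by simp [hu])
    have h1 := ih (g := fun u => g (1 :: u)) (h := fun u => h (1 :: u))
      fun u hu => H _ (by simp [hu])
    simp only [avg]
    linarith

theorem avg_congr {n : ℕ} {g h : List (Fin 2) → ℝ} (H : ∀ u, u.length = n → g u = h u) :
    avg n g = avg n h :=
  le_antisymm (avg_mono fun u hu => (H u hu).le) (avg_mono fun u hu => (H u hu).ge)

theorem avg_const (n : ℕ) (c : ℝ) : avg n (fun _ => c) = c := by
  induction n with
  | zero => rfl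
  | succ n ih => simp only [avg, ih]; ring

theorem avg_add (n : ℕ) (g h : List (Fin 2) → ℝ) :
    avg n (fun u => g u + h u) = avg n g + avg n h := by
  induction n generalizing g h with
  | zero => rfl
  | succ n ih => simp only [avg, ih]; ring

theorem avg_const_mul (n : ℕ) (c : ℝ) (g : List (Fin 2) → ℝ) :
    avg n (fun u => c * g u) = c * avg n g := by
  induction n generalizing g with
  | zero => rfl
  | succ n ih => simp only [avg, ih]; ring

theorem avg_neg (n : ℕ) (g : List (Fin 2) → ℝ) : avg n (fun u => -g u) = -avg n g := by
  simpa using avg_const_mul n (-1) g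

theorem avg_sub (n : ℕ) (g h : List (Fin 2) → ℝ) :
    avg n (fun u => g u - h u) = avg n g - avg n h := by
  simp only [sub_eq_add_neg, avg_add, avg_neg]

theorem avg_sum {ι : Type*} (s : Finset ι) (n : ℕ) (g : ι → List (Fin 2) → ℝ) :
    avg n (fun u => ∑ i ∈ s, g i u) = ∑ i ∈ s, avg n (g i) := by
  classical
  induction s using Finset.induction_on with
  | empty => simp [avg_const]
  | insert i s hi ih => simp only [Finset.sum_insert hi, avg_add, ih]

theorem avg_nonneg {n : ℕ} {g : List (Fin 2) → ℝ} (H : ∀ u, u.length = n → 0 ≤ g u) :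
    0 ≤ avg n g := by
  simpa [avg_const] using avg_mono (g := fun _ => 0) H

theorem avg_append (n m : ℕ) (g : List (Fin 2) → ℝ) :
    avg (n + m) g = avg n (fun u => avg m (fun v => g (u ++ v))) := by
  induction n generalizing g with
  | zero => simp [avg]
  | succ n ih =>
    rw [show n + 1 + m = (n + m) + 1 by ring]
    simp only [avg, ih, List.cons_append]

theorem avg_comm (n m : ℕ) (g : List (Fin 2) → List (Fin 2) → ℝ) :
    avg n (fun u => avg m (fun v => g u v)) = avg m (fun v => avg n (fun u => g u v)) := by
  induction n generalizing g with
  | zero => rfl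
  | succ n ih =>
    simp only [avg, ih]
    rw [← avg_add]
    simp only [div_eq_inv_mul, avg_const_mul]

theorem avg_take {n i : ℕ} (h : i ≤ n) (g : List (Fin 2) → ℝ) :
    avg n (fun u => g (u.take i)) = avg i g := by
  obtain ⟨m, rfl⟩ := Nat.exists_eq_add_of_le h
  rw [avg_append]
  refine avg_congr fun u hu => ?_
  rw [← avg_const m (g u)]
  exact avg_congr fun v _ => by rw [← hu, List.take_left]

theorem avg_drop {n j : ℕ} (h : j ≤ n) (g : List (Fin 2) → ℝ) :
    avg n (fun u => g (u.drop j)) = avg (n - j) g := by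
  obtain ⟨m, rfl⟩ := Nat.exists_eq_add_of_le h
  rw [avg_append, Nat.add_sub_cancel_left, ← avg_const j (avg m g)]
  refine avg_congr fun u hu => ?_
  exact avg_congr fun v _ => by rw [← hu, List.drop_left]

theorem avg_eq_sum (n : ℕ) (g : List (Fin 2) → ℝ) :
    avg n g = (∑ x : Fin n → Fin 2, g (List.ofFn x)) / 2 ^ n := by
  induction n generalizing g with
  | zero => simp [avg]
  | succ n ih =>
    have hc : ∀ (c : Fin 2) (y : Fin n → Fin 2),
        List.ofFn (Fin.consEquiv (fun _ : Fin (n + 1) => Fin 2) (c, y)) = c :: List.ofFn y :=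
      fun c y => List.ofFn_cons c y
    simp only [avg, ih]
    rw [← (Fin.consEquiv (fun _ : Fin (n + 1) => Fin 2)).sum_comp]
    rw [Fintype.sum_prod_type]
    simp only [Fin.sum_univ_two, hc]
    rw [pow_succ]
    field_simp

/-- Changing one letter changes the function by at most `1`. -/
def BddDiff (g : List (Fin 2) → ℝ) : Prop :=
  ∀ u v a b, |g (u ++ a :: v) - g (u ++ b :: v)| ≤ 1

theorem BddDiff.neg {g : List (Fin 2) → ℝ} (hg : BddDiff g) : BddDiff (fun u => -g u) := by
  intro u v a b
  have := hg u v b a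
  rwa [show -g (u ++ a :: v) - -g (u ++ b :: v) = g (u ++ b :: v) - g (u ++ a :: v) by ring]

theorem BddDiff.cons {g : List (Fin 2) → ℝ} (hg : BddDiff g) (c : Fin 2) :
    BddDiff (fun u => g (c :: u)) :=
  fun u v a b => hg (c :: u) v a b

theorem BddDiff.avg {g : List (Fin 2) → List (Fin 2) → ℝ} (hg : ∀ y, BddDiff (fun x => g x y))
    (n : ℕ) : BddDiff (fun x => avg n (g x)) := by
  intro u v a b
  dsimp only
  rw [← avg_sub, abs_le]
  constructor
  · rw [← avg_const n (-1)]
    exact avg_mono fun y _ => (abs_le.1 (hg y u v a b)).1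
  · rw [← avg_const n 1]
    exact avg_mono fun y _ => (abs_le.1 (hg y u v a b)).2

/-- The exponential moment bound behind McDiarmid's inequality. -/
theorem avg_exp_le {g : List (Fin 2) → ℝ} (hg : BddDiff g) (l : ℝ) (n : ℕ) :
    avg n (fun u => Real.exp (l * g u)) ≤ Real.exp (l * avg n g + l ^ 2 * n / 8) := by
  induction n generalizing g with
  | zero => simp [avg]
  | succ n ih =>
    have h0 := ih (hg.cons 0)
    have h1 := ih (hg.cons 1)
    simp only [avg]
    set m0 := avg n (fun u => g (0 :: u))
    set m1 := avg n (fun u => g (1 :: u))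
    have hd : |m0 - m1| ≤ 1 := by
      simp only [m0, m1]
      rw [← avg_sub, abs_le]
      constructor
      · rw [← avg_const n (-1)]
        exact avg_mono fun y _ => (abs_le.1 (hg [] y 0 1)).1
      · rw [← avg_const n 1]
        exact avg_mono fun y _ => (abs_le.1 (hg [] y 0 1)).2
    have hc := Real.cosh_le_exp_half_sq (l * (m0 - m1) / 2)
    have hsq : (m0 - m1) ^ 2 ≤ 1 := by
      rw [← sq_abs]
      exact pow_le_one₀ (abs_nonneg _) hd
    calc (avg n (fun u => Real.exp (l * g (0 :: u))) +
          avg n (fun u => Real.exp (l * g (1 :: u)))) / 2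
        ≤ (Real.exp (l * m0 + l ^ 2 * n / 8) + Real.exp (l * m1 + l ^ 2 * n / 8)) / 2 := by linarith
      _ = Real.exp (l * ((m0 + m1) / 2) + l ^ 2 * n / 8) * Real.cosh (l * (m0 - m1) / 2) := by
          rw [Real.cosh_eq, mul_div_assoc', mul_add, ← Real.exp_add, ← Real.exp_add]
          congr 3 <;> ring
      _ ≤ Real.exp (l * ((m0 + m1) / 2) + l ^ 2 * n / 8)
            * Real.exp ((l * (m0 - m1) / 2) ^ 2 / 2) := by gcongr
      _ ≤ _ := by
          rw [← Real.exp_add]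
          apply Real.exp_le_exp.2
          push_cast
          nlinarith [sq_nonneg l]

theorem avg_avg_exp_le {g : List (Fin 2) → List (Fin 2) → ℝ} (h1 : ∀ y, BddDiff fun x => g x y)
    (h2 : ∀ x, BddDiff (g x)) (l : ℝ) (m n : ℕ) :
    avg m (fun x => avg n (fun y => Real.exp (l * g x y))) ≤
      Real.exp (l * avg m (fun x => avg n (g x)) + l ^ 2 * (m + n) / 8) := by
  calc _ ≤ avg m (fun x => Real.exp (l * avg n (g x) + l ^ 2 * n / 8)) :=
        avg_mono fun x _ => avg_exp_le (h2 x) l n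
    _ = Real.exp (l ^ 2 * n / 8) * avg m (fun x => Real.exp (l * avg n (g x))) := by
        rw [← avg_const_mul]
        exact avg_congr fun x _ => by rw [← Real.exp_add, add_comm]
    _ ≤ Real.exp (l ^ 2 * n / 8) * Real.exp (l * avg m (fun x => avg n (g x)) + l ^ 2 * m / 8) := by
        gcongr
        exact avg_exp_le (BddDiff.avg h1 n) l m
    _ = _ := by
        rw [← Real.exp_add]
        congr 1
        ring

/-! ### Events for a pair of independent words, and concentration -/

open Classical in
/-- The probability that two independent uniform binary words of lengths `m` and `n`
satisfy `Q`. -/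
def wordProb (m n : ℕ) (Q : List (Fin 2) → List (Fin 2) → Prop) : ℝ :=
  avg m fun x => avg n fun y => if Q x y then 1 else 0

theorem wordProb_mono {m n : ℕ} {Q R : List (Fin 2) → List (Fin 2) → Prop}
    (H : ∀ x y, x.length = m → y.length = n → Q x y → R x y) :
    wordProb m n Q ≤ wordProb m n R := by
  refine avg_mono fun x hx => avg_mono fun y hy => ?_
  have := H x y hx hy
  split_ifs <;> first | tauto | norm_num

theorem wordProb_or_le (m n : ℕ) (Q R : List (Fin 2) → List (Fin 2) → Prop) :
    wordProb m n (fun x y => Q x y ∨ R x y) ≤ wordProb m n Q + wordProb m n R := by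
  unfold wordProb
  rw [← avg_add]
  refine avg_mono fun x hx => ?_
  rw [← avg_add]
  refine avg_mono fun y hy => ?_
  dsimp only
  split_ifs <;> first | tauto | norm_num

theorem wordProb_exists_le {ι : Type*} (s : Finset ι) (m n : ℕ)
    (Q : ι → List (Fin 2) → List (Fin 2) → Prop) :
    wordProb m n (fun x y => ∃ i ∈ s, Q i x y) ≤ ∑ i ∈ s, wordProb m n (Q i) := by
  classical
  induction s using Finset.induction_on with
  | empty => simp [wordProb, avg_const]
  | insert i s hi ih =>
    rw [Finset.sum_insert hi]
    refine le_trans ?_ (le_trans (wordProb_or_le m n (Q i) fun x y => ∃ i ∈ s, Q i x y) ?_)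
    · refine wordProb_mono fun x y _ _ => ?_
      simp
    · linarith

/-- Concentration of a function of two words that depends little on each letter. -/
theorem wordProb_abs_sub_le {g : List (Fin 2) → List (Fin 2) → ℝ} (h1 : ∀ y, BddDiff fun x => g x y)
    (h2 : ∀ x, BddDiff (g x)) {m n : ℕ} {t M : ℝ} (ht : 0 ≤ t) (hM : 0 < M)
    (hmn : (m : ℝ) + n ≤ M) :
    wordProb m n (fun x y => t ≤ |g x y - avg m (fun x => avg n (g x))|) ≤
      2 * Real.exp (-(2 * t ^ 2 / M)) := by
  have key : ∀ g : List (Fin 2) → List (Fin 2) → ℝ, (∀ y, BddDiff fun x => g x y) →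
      (∀ x, BddDiff (g x)) →
      wordProb m n (fun x y => t ≤ g x y - avg m (fun x => avg n (g x))) ≤
        Real.exp (-(2 * t ^ 2 / M)) := by
    intro g h1 h2
    set μ := avg m (fun x => avg n (g x)) with hμ
    set l : ℝ := 4 * t / M with hl
    have hl0 : 0 ≤ l := by positivity
    have e1 := avg_avg_exp_le h1 h2 l m n
    rw [← hμ] at e1
    calc wordProb m n (fun x y => t ≤ g x y - μ)
        ≤ avg m (fun x => avg n (fun y => Real.exp (-(l * μ) - l * t) * Real.exp (l * g x y))) := by
          refine avg_mono fun x _ => avg_mono fun y _ => ?_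
          rw [← Real.exp_add]
          split_ifs with h
          · apply Real.one_le_exp
            nlinarith
          · positivity
      _ = Real.exp (-(l * μ) - l * t) * avg m (fun x => avg n (fun y => Real.exp (l * g x y))) := by
          refine Eq.trans ?_ (avg_const_mul m _ _)
          exact avg_congr fun x _ => avg_const_mul n _ _
      _ ≤ Real.exp (-(l * μ) - l * t) * Real.exp (l * μ + l ^ 2 * (m + n) / 8) := by
          gcongr
      _ ≤ _ := by
          rw [← Real.exp_add]
          apply Real.exp_le_exp.2
          have hb : l ^ 2 * ((m : ℝ) + n) ≤ l ^ 2 * M := by gcongr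
          have h3 : l ^ 2 * M / 8 = 2 * t ^ 2 / M := by rw [hl]; field_simp; ring
          have h4 : l * t = 4 * t ^ 2 / M := by rw [hl]; ring
          have h5 : 4 * t ^ 2 / M = 2 * (2 * t ^ 2 / M) := by ring
          linarith
  have k1 := key g h1 h2
  have k2 := key (fun x y => -g x y) (fun y => (h1 y).neg) (fun x => (h2 x).neg)
  simp only [avg_neg] at k2
  have k3 := wordProb_or_le m n (fun x y => t ≤ g x y - avg m (fun x => avg n (g x)))
    (fun x y => t ≤ -g x y - -avg m (fun x => avg n (g x)))
  have k4 : wordProb m n (fun x y => t ≤ |g x y - avg m (fun x => avg n (g x))|) ≤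
      wordProb m n (fun x y => t ≤ g x y - avg m (fun x => avg n (g x)) ∨
        t ≤ -g x y - -avg m (fun x => avg n (g x))) := by
    refine wordProb_mono fun x y _ _ h => ?_
    rcases le_abs.1 h with h | h
    · exact Or.inl h
    · right; linarith
  linarith

/-! ### The mean length of the longest common subsequence -/

/-- The mean LCS of two independent uniform binary words of lengths `m` and `n`. -/
def ecs (m n : ℕ) : ℝ := avg m fun x => avg n fun y => (lcs x y : ℝ)

theorem meanLCS_two (m n : ℕ) : meanLCS 2 m n = ecs m n := by
  unfold meanLCS ecs lcsFn
  simp only [avg_eq_sum]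
  rw [← Finset.sum_div, div_div, pow_add, mul_comm]
  norm_num

theorem bddDiff_lcs_left (y : List (Fin 2)) : BddDiff fun x => (lcs x y : ℝ) := by
  have key : ∀ (u v : List (Fin 2)) (a b : Fin 2),
      (lcs (u ++ a :: v) y : ℝ) ≤ lcs (u ++ b :: v) y + 1 := by
    intro u v a b
    have h1 := lcs_insert_le u v y a
    have h2 : lcs (u ++ v) y ≤ lcs (u ++ b :: v) y :=
      lcs_mono ((List.Sublist.refl _).append (List.sublist_cons_self _ _)) (List.Sublist.refl _)
    exact_mod_cast h1.trans (by omega)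
  intro u v a b
  rw [abs_le]
  constructor <;> linarith [key u v a b, key u v b a]

theorem bddDiff_lcs_right (x : List (Fin 2)) : BddDiff fun y => (lcs x y : ℝ) := by
  simp_rw [lcs_comm x]
  exact bddDiff_lcs_left x

theorem ecs_comm (m n : ℕ) : ecs m n = ecs n m := by
  unfold ecs
  rw [avg_comm]
  simp_rw [lcs_comm]

theorem ecs_nonneg (m n : ℕ) : 0 ≤ ecs m n :=
  avg_nonneg fun _ _ => avg_nonneg fun _ _ => Nat.cast_nonneg _

theorem ecs_le_left (m n : ℕ) : ecs m n ≤ m := by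
  rw [← avg_const m (m : ℝ)]
  refine avg_mono fun x hx => ?_
  rw [← avg_const n (m : ℝ)]
  refine avg_mono fun y hy => ?_
  rw [← hx]
  exact_mod_cast lcs_le_length_left x y

theorem ecs_superadd (m n m' n' : ℕ) : ecs m n + ecs m' n' ≤ ecs (m + m') (n + n') := by
  have h : ecs (m + m') (n + n') = avg m fun x => avg m' fun x' => avg n fun y => avg n' fun y' =>
      (lcs (x ++ x') (y ++ y') : ℝ) := by
    simp only [ecs, avg_append]
  have h1 : ecs m n = avg m fun x => avg m' fun _ => avg n fun y => avg n' fun _ =>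
      (lcs x y : ℝ) := by simp only [ecs, avg_const]
  have h2 : ecs m' n' = avg m fun _ => avg m' fun x' => avg n fun _ => avg n' fun y' =>
      (lcs x' y' : ℝ) := by simp only [ecs, avg_const]
  rw [h, h1, h2]
  simp only [← avg_add]
  refine avg_mono fun x _ => avg_mono fun x' _ => avg_mono fun y _ => avg_mono fun y' _ => ?_
  exact_mod_cast lcs_append_le x y x' y'

theorem ecs_add_left_le (m m' n : ℕ) : ecs (m + m') n ≤ ecs m n + m' := by
  have h : ecs (m + m') n = avg m fun x => avg m' fun x' => avg n fun y =>
      (lcs (x ++ x') y : ℝ) := by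
    simp only [ecs, avg_append]
  have h1 : ecs m n + m' = avg m fun x => avg m' fun _ => avg n fun y =>
      (lcs x y + m' : ℝ) := by simp only [ecs, avg_const, avg_add]
  rw [h, h1]
  refine avg_mono fun x _ => avg_mono fun x' hx' => avg_mono fun y _ => ?_
  rw [← hx']
  exact_mod_cast lcs_append_le_add_length x x' y

theorem ecs_mono {m m' n n' : ℕ} (hm : m ≤ m') (hn : n ≤ n') : ecs m n ≤ ecs m' n' := by
  obtain ⟨a, rfl⟩ := Nat.exists_eq_add_of_le hm
  obtain ⟨b, rfl⟩ := Nat.exists_eq_add_of_le hn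
  linarith [ecs_superadd m n a b, ecs_nonneg a b]

theorem ecs_add_le (m n a b : ℕ) : ecs (m + a) (n + b) ≤ ecs m n + a + b := by
  have h1 := ecs_add_left_le m a (n + b)
  have h2 := ecs_add_left_le n b m
  rw [ecs_comm, ecs_comm n m] at h2
  linarith

/-! ### The limiting mean length -/

theorem ecs_mul_ge (k m n : ℕ) : k * ecs m n ≤ ecs (k * m) (k * n) := by
  induction k with
  | zero => simpa using ecs_nonneg 0 0
  | succ k ih =>
    have := ecs_superadd (k * m) (k * n) m n
    rw [Nat.succ_mul, Nat.succ_mul]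
    push_cast
    linarith

theorem subadditive_neg_ecs (m n : ℕ) : Subadditive fun k : ℕ => -ecs (k * m) (k * n) := by
  intro j k
  have := ecs_superadd (j * m) (j * n) (k * m) (k * n)
  simp only [add_mul]
  linarith

/-- `lim ecs (k m) (k n) / k`: the homogeneous function which governs the mean LCS of words
whose lengths have the ratio `m : n`. -/
def limLCS (m n : ℕ) : ℝ := -(subadditive_neg_ecs m n).lim

theorem bddBelow_neg_ecs (m n : ℕ) :
    BddBelow (Set.range fun k : ℕ => -ecs (k * m) (k * n) / k) := by
  refine ⟨-m, ?_⟩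
  rintro _ ⟨k, rfl⟩
  rcases Nat.eq_zero_or_pos k with rfl | hk
  · simp
  · have h := ecs_le_left (k * m) (k * n)
    have hk' : (0 : ℝ) < k := by exact_mod_cast hk
    dsimp only
    rw [le_div_iff₀ hk']
    push_cast at h
    linarith

theorem tendsto_ecs_div (m n : ℕ) :
    Tendsto (fun k : ℕ => ecs (k * m) (k * n) / k) atTop (𝓝 (limLCS m n)) := by
  have := ((subadditive_neg_ecs m n).tendsto_lim (bddBelow_neg_ecs m n)).neg
  simpa only [neg_div, neg_neg, limLCS] using this

theorem ecs_le_limLCS (m n : ℕ) : ecs m n ≤ limLCS m n := by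
  have := (subadditive_neg_ecs m n).lim_le_div (bddBelow_neg_ecs m n) one_ne_zero
  simp only [one_mul, Nat.cast_one, div_one] at this
  unfold limLCS
  linarith

theorem limLCS_le_of_forall {m n : ℕ} {B : ℝ} (h : ∀ k : ℕ, ecs (k * m) (k * n) ≤ k * B) :
    limLCS m n ≤ B := by
  refine le_of_tendsto (tendsto_ecs_div m n) ?_
  filter_upwards [eventually_gt_atTop 0] with k hk
  have hk' : (0 : ℝ) < k := by exact_mod_cast hk
  rw [div_le_iff₀ hk', mul_comm B]
  exact h k

theorem limLCS_le_left (m n : ℕ) : limLCS m n ≤ m :=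
  limLCS_le_of_forall fun k => by simpa using ecs_le_left (k * m) (k * n)

theorem limLCS_comm (m n : ℕ) : limLCS m n = limLCS n m :=
  tendsto_nhds_unique (tendsto_ecs_div m n)
    (by simpa only [ecs_comm] using tendsto_ecs_div n m)

theorem limLCS_superadd (m n m' n' : ℕ) :
    limLCS m n + limLCS m' n' ≤ limLCS (m + m') (n + n') := by
  refine le_of_tendsto_of_tendsto' ((tendsto_ecs_div m n).add (tendsto_ecs_div m' n'))
    (tendsto_ecs_div (m + m') (n + n')) fun k => ?_
  rw [← add_div, mul_add, mul_add]
  gcongr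
  exact ecs_superadd _ _ _ _

theorem limLCS_nonneg (m n : ℕ) : 0 ≤ limLCS m n := (ecs_nonneg m n).trans (ecs_le_limLCS m n)

theorem limLCS_add_le (m n a b : ℕ) : limLCS (m + a) (n + b) ≤ limLCS m n + a + b := by
  have : Tendsto (fun k : ℕ => ecs (k * m) (k * n) / k + a + b) atTop
      (𝓝 (limLCS m n + a + b)) := ((tendsto_ecs_div m n).add_const _).add_const _
  refine le_of_tendsto_of_tendsto (tendsto_ecs_div (m + a) (n + b)) this ?_
  filter_upwards [eventually_gt_atTop 0] with k hk
  have hk' : (0 : ℝ) < k := by exact_mod_cast hk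
  have h := ecs_add_le (k * m) (k * n) (k * a) (k * b)
  rw [mul_add, mul_add, div_le_iff₀ hk', add_mul, add_mul, div_mul_cancel₀ _ hk'.ne']
  push_cast at h
  linarith

theorem limLCS_mul (k m n : ℕ) : limLCS (k * m) (k * n) = k * limLCS m n := by
  rcases Nat.eq_zero_or_pos k with rfl | hk
  · have h1 := limLCS_le_left 0 0
    have h2 := limLCS_nonneg 0 0
    simp only [Nat.cast_zero] at h1
    simp only [zero_mul, Nat.cast_zero]
    linarith
  · have hk' : (0 : ℝ) < k := by exact_mod_cast hk
    have h : Tendsto (fun j : ℕ => j * k) atTop atTop :=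
      tendsto_id.atTop_mul_const' hk
    refine tendsto_nhds_unique (tendsto_ecs_div (k * m) (k * n))
      ((((tendsto_ecs_div m n).comp h).const_mul (k : ℝ)).congr fun j => ?_)
    simp only [Function.comp, Nat.cast_mul, mul_assoc]
    rcases Nat.eq_zero_or_pos j with rfl | hj
    · simp
    · have hj' : (0 : ℝ) < j := by exact_mod_cast hj
      field_simp

theorem gammaStar_two : gammaStar 2 = limLCS 1 1 := by
  refine Tendsto.limUnder_eq ?_
  simpa [meanLCS_two] using tendsto_ecs_div 1 1

/-- Among all pairs of words with a given total length, equal lengths are best. -/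
theorem limLCS_le (m n : ℕ) : limLCS m n ≤ gammaStar 2 * (m + n) / 2 := by
  have h1 := limLCS_superadd m n n m
  have h2 := limLCS_mul (m + n) 1 1
  rw [limLCS_comm n m, add_comm n m] at h1
  rw [mul_one, ← gammaStar_two] at h2
  push_cast at h2
  linarith

theorem ecs_le (m n : ℕ) : ecs m n ≤ gammaStar 2 * (m + n) / 2 :=
  (ecs_le_limLCS m n).trans (limLCS_le m n)

theorem gammaStar_nonneg : 0 ≤ gammaStar 2 := gammaStar_two ▸ limLCS_nonneg 1 1

/-! ### The rate of convergence -/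

theorem exp_avg_le (n : ℕ) (g : List (Fin 2) → ℝ) :
    Real.exp (avg n g) ≤ avg n (fun u => Real.exp (g u)) := by
  set μ := avg n g with hμ
  have h : avg n (fun u => Real.exp μ * (1 - μ) + Real.exp μ * g u) ≤
      avg n (fun u => Real.exp (g u)) := by
    refine avg_mono fun u _ => ?_
    have h1 := Real.add_one_le_exp (g u - μ)
    have h2 : Real.exp (g u) = Real.exp μ * Real.exp (g u - μ) := by
      rw [← Real.exp_add]; congr 1; ring
    rw [h2, ← mul_add]
    gcongr
    linarith
  rw [avg_add, avg_const, avg_const_mul, ← hμ] at h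
  linarith

/-- The exponential moment of the LCS. -/
def lcsMGF (l : ℝ) (m n : ℕ) : ℝ := avg m fun x => avg n fun y => Real.exp (l * lcs x y)

theorem exp_ecs_le_lcsMGF (l : ℝ) (m n : ℕ) : Real.exp (l * ecs m n) ≤ lcsMGF l m n := by
  unfold ecs lcsMGF
  rw [← avg_const_mul]
  refine (exp_avg_le _ _).trans (avg_mono fun x _ => ?_)
  rw [← avg_const_mul]
  exact exp_avg_le _ _

theorem lcsMGF_le (l : ℝ) (m n : ℕ) :
    lcsMGF l m n ≤ Real.exp (l * ecs m n + l ^ 2 * (m + n) / 8) :=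
  avg_avg_exp_le bddDiff_lcs_left bddDiff_lcs_right l m n

theorem avg_avg_take_mul_drop {a b m n : ℕ} (ha : a ≤ m) (hb : b ≤ n)
    (F H : List (Fin 2) → List (Fin 2) → ℝ) :
    avg m (fun x => avg n fun y => F (x.take a) (y.take b) * H (x.drop a) (y.drop b)) =
      avg a (fun x => avg b (F x)) * avg (m - a) (fun x => avg (n - b) (H x)) := by
  obtain ⟨m, rfl⟩ := Nat.exists_eq_add_of_le ha
  obtain ⟨n, rfl⟩ := Nat.exists_eq_add_of_le hb
  simp only [avg_append, Nat.add_sub_cancel_left]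
  have h1 : ∀ x x' : List (Fin 2), x.length = a →
      avg b (fun y => avg n fun y' => F ((x ++ x').take a) ((y ++ y').take b) *
        H ((x ++ x').drop a) ((y ++ y').drop b)) = avg n (H x') * avg b (F x) := by
    intro x x' hx
    rw [← avg_const_mul]
    refine avg_congr fun y hy => ?_
    rw [mul_comm, ← avg_const_mul]
    refine avg_congr fun y' _ => ?_
    rw [← hx, ← hy, List.take_left, List.take_left, List.drop_left, List.drop_left]
  rw [mul_comm, ← avg_const_mul]
  refine avg_congr fun x hx => ?_
  rw [mul_comm, ← avg_const_mul]
  refine avg_congr fun x' _ => ?_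
  rw [h1 x x' hx, mul_comm]

theorem lcsMGF_le_sum {l : ℝ} (hl : 0 ≤ l) {m n N : ℕ} (hN : N ≤ m + n) :
    lcsMGF l m n ≤ ∑ a ∈ (Finset.range (N + 1)).filter (fun a => a ≤ m ∧ N - a ≤ n),
      Real.exp l * (lcsMGF l a (N - a) * lcsMGF l (m - a) (n - (N - a))) := by
  set s := (Finset.range (N + 1)).filter (fun a => a ≤ m ∧ N - a ≤ n) with hs
  have h : ∀ a ∈ s, Real.exp l * (lcsMGF l a (N - a) * lcsMGF l (m - a) (n - (N - a))) =
      avg m fun x => avg n fun y => Real.exp l *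
        (Real.exp (l * lcs (x.take a) (y.take (N - a))) *
          Real.exp (l * lcs (x.drop a) (y.drop (N - a)))) := by
    intro a ha
    simp only [hs, Finset.mem_filter, Finset.mem_range] at ha
    unfold lcsMGF
    rw [← avg_avg_take_mul_drop ha.2.1 ha.2.2 (fun x y => Real.exp (l * lcs x y))
      (fun x y => Real.exp (l * lcs x y)), ← avg_const_mul]
    exact avg_congr fun x _ => (avg_const_mul _ _ _).symm
  rw [Finset.sum_congr rfl h, ← avg_sum]
  refine avg_mono fun x hx => ?_
  rw [← avg_sum]
  refine avg_mono fun y hy => ?_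
  obtain ⟨x₁, x₂, y₁, y₂, rfl, rfl, hlen, hle⟩ := exists_cut x y N (by omega)
  simp only [List.length_append] at hx hy
  have hmem : x₁.length ∈ s := by
    simp only [hs, Finset.mem_filter, Finset.mem_range]
    omega
  refine le_trans ?_ (Finset.single_le_sum (fun a _ => by positivity) hmem)
  rw [show N - x₁.length = y₁.length by omega, List.take_left, List.take_left, List.drop_left,
    List.drop_left, ← Real.exp_add, ← Real.exp_add]
  apply Real.exp_le_exp.2
  have : (lcs (x₁ ++ x₂) (y₁ ++ y₂) : ℝ) ≤ lcs x₁ y₁ + lcs x₂ y₂ + 1 := by exact_mod_cast hle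
  nlinarith

theorem lcsMGF_nonneg (l : ℝ) (m n : ℕ) : 0 ≤ lcsMGF l m n :=
  avg_nonneg fun _ _ => avg_nonneg fun _ _ => (Real.exp_pos _).le

/-- A linear function that dominates the mean LCS at total length `N` dominates it, up to an
error per piece of length `N`, at all multiples of `N`: an optimal alignment of long words
splits into pieces of total length `N`, and there are few ways to choose these pieces. -/
theorem ecs_le_linear {N : ℕ} {l p q : ℝ} (hl : 0 < l)
    (h : ∀ a b : ℕ, a + b = N → ecs a b ≤ p * a + q * b) (T m n : ℕ) (hmn : m + n = T * N) :
    ecs m n ≤ p * m + q * n + T * (1 + Real.log (N + 1) / l + l * N / 8) := by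
  set K : ℝ := (N + 1) * Real.exp (l + l ^ 2 * N / 8) with hK
  have hK0 : 0 < K := by positivity
  have key : lcsMGF l m n ≤ K ^ T * Real.exp (l * (p * m + q * n)) := by
    induction T generalizing m n with
    | zero =>
      have hm : m = 0 := by omega
      have hn : n = 0 := by omega
      subst hm hn
      have : lcs ([] : List (Fin 2)) [] = 0 := by
        simpa using lcs_le_length_left ([] : List (Fin 2)) []
      simp [lcsMGF, avg, this]
    | succ T ih =>
      have hmn' : m + n = T * N + N := by rw [hmn]; ring
      refine (lcsMGF_le_sum hl.le (by omega : N ≤ m + n)).trans ?_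
      have hterm : ∀ a ∈ (Finset.range (N + 1)).filter (fun a => a ≤ m ∧ N - a ≤ n),
          Real.exp l * (lcsMGF l a (N - a) * lcsMGF l (m - a) (n - (N - a))) ≤
          Real.exp (l + l ^ 2 * N / 8) * (K ^ T * Real.exp (l * (p * m + q * n))) := by
        intro a ha
        simp only [Finset.mem_filter, Finset.mem_range] at ha
        obtain ⟨b, hb⟩ : ∃ b, a + b = N := ⟨N - a, by omega⟩
        have hbn : N - a = b := by omega
        rw [hbn] at ha ⊢
        have e1 := lcsMGF_le l a b
        have e2 := ih (m - a) (n - b) (by omega)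
        have e3 : Real.exp (l * ecs a b + l ^ 2 * (a + b) / 8) ≤
            Real.exp (l * (p * a + q * b) + l ^ 2 * N / 8) := by
          apply Real.exp_le_exp.2
          have h3 := h a b hb
          have h4 : (a : ℝ) + b = N := by exact_mod_cast hb
          rw [h4]
          gcongr
        rw [Nat.cast_sub ha.2.1, Nat.cast_sub ha.2.2] at e2
        calc Real.exp l * (lcsMGF l a b * lcsMGF l (m - a) (n - b))
            ≤ Real.exp l * (Real.exp (l * (p * a + q * b) + l ^ 2 * N / 8) *
              (K ^ T * Real.exp (l * (p * (m - a) + q * (n - b))))) := by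
              gcongr
              · exact lcsMGF_nonneg _ _ _
              · exact e1.trans e3
          _ = Real.exp l * Real.exp (l * (p * a + q * b) + l ^ 2 * N / 8) *
              Real.exp (l * (p * (m - a) + q * (n - b))) * K ^ T := by ring
          _ = Real.exp (l + l ^ 2 * N / 8) * Real.exp (l * (p * m + q * n)) * K ^ T := by
              congr 1
              rw [← Real.exp_add, ← Real.exp_add, ← Real.exp_add]
              congr 1
              ring
          _ = _ := by ring
      refine (Finset.sum_le_card_nsmul _ _ _ hterm).trans ?_
      rw [nsmul_eq_mul]
      have hcard : (((Finset.range (N + 1)).filter (fun a => a ≤ m ∧ N - a ≤ n)).card : ℝ) ≤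
          N + 1 := by
        exact_mod_cast (Finset.card_filter_le _ _).trans (Finset.card_range _).le
      calc _ ≤ ((N : ℝ) + 1) *
            (Real.exp (l + l ^ 2 * N / 8) * (K ^ T * Real.exp (l * (p * m + q * n)))) := by
            gcongr
        _ = _ := by
            rw [pow_succ K]
            generalize K ^ T = Z
            rw [hK]
            ring
  have h1 := (exp_ecs_le_lcsMGF l m n).trans key
  have h2 := Real.log_le_log (Real.exp_pos _) h1
  rw [Real.log_exp, Real.log_mul (by positivity) (Real.exp_pos _).ne', Real.log_exp,
    Real.log_pow, hK, Real.log_mul (by positivity) (Real.exp_pos _).ne', Real.log_exp] at h2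
  have h3 : (T : ℝ) * (1 + Real.log (N + 1) / l + l * N / 8) * l =
      T * (Real.log (N + 1) + (l + l ^ 2 * N / 8)) := by
    field_simp
    ring
  nlinarith

/-- A function on `{0, …, N}` has a supporting line above it that touches it on both sides of a
given point. -/
theorem exists_supporting_line (h : ℕ → ℝ) (N : ℕ) (c : ℝ) (hc0 : 0 ≤ c) (hcN : c < N) :
    ∃ a₁ a₂ : ℕ, ∃ s t : ℝ, a₁ ≤ N ∧ a₂ ≤ N ∧ (a₁ : ℝ) ≤ c ∧ c < a₂ ∧
      h a₁ = t + s * a₁ ∧ h a₂ = t + s * a₂ ∧ ∀ a ≤ N, h a ≤ t + s * a := by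
  classical
  set L := (Finset.range (N + 1)).filter (fun a : ℕ => (a : ℝ) ≤ c) with hL
  set U := (Finset.range (N + 1)).filter (fun a : ℕ => c < (a : ℝ)) with hU
  have hLne : L.Nonempty := ⟨0, by simp [hL, hc0]⟩
  have hUne : U.Nonempty := ⟨N, by simp [hU, hcN]⟩
  have mL : ∀ a, a ∈ L ↔ a ≤ N ∧ (a : ℝ) ≤ c := fun a => by simp [hL]
  have mU : ∀ a, a ∈ U ↔ a ≤ N ∧ c < (a : ℝ) := fun a => by simp [hU]
  let chord : ℕ × ℕ → ℝ := fun p =>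
    (h p.1 * (p.2 - c) + h p.2 * (c - p.1)) / (p.2 - p.1)
  obtain ⟨⟨b₁, b₂⟩, hb, hmax⟩ := Finset.exists_max_image (L ×ˢ U) chord (hLne.product hUne)
  obtain ⟨hb1, hb2⟩ := Finset.mem_product.1 hb
  set v := chord (b₁, b₂) with hv
  have hchord : ∀ a ∈ L, ∀ b ∈ U, h a * (b - c) + h b * (c - a) ≤ v * (b - a) := by
    intro a ha b hb
    have h1 := hmax (a, b) (Finset.mem_product.2 ⟨ha, hb⟩)
    have h2 : (0 : ℝ) < b - a := by linarith [((mL a).1 ha).2, ((mU b).1 hb).2]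
    exact (div_le_iff₀ h2).1 h1
  have hveq : h b₁ * (b₂ - c) + h b₂ * (c - b₁) = v * (b₂ - b₁) := by
    have h2 : (0 : ℝ) < b₂ - b₁ := by linarith [((mL b₁).1 hb1).2, ((mU b₂).1 hb2).2]
    exact (div_eq_iff h2.ne').1 hv.symm
  obtain ⟨a₂, ha2, hmax2⟩ := Finset.exists_max_image U (fun b => (h b - v) / (b - c)) hUne
  set s := (h a₂ - v) / (a₂ - c) with hs
  have hpos : ∀ b ∈ U, (0 : ℝ) < b - c := fun b hb => by linarith [((mU b).1 hb).2]
  have hsU : ∀ b ∈ U, h b ≤ v + s * (b - c) := by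
    intro b hb
    have := (div_le_iff₀ (hpos b hb)).1 (hmax2 b hb)
    linarith
  have hs2 : h a₂ = v + s * (a₂ - c) := by
    rw [hs, div_mul_cancel₀ _ (hpos a₂ ha2).ne']
    ring
  have hsL : ∀ a ∈ L, h a ≤ v + s * (a - c) := by
    intro a ha
    have h1 := hchord a ha a₂ ha2
    have h2 := hpos a₂ ha2
    rw [hs2] at h1
    have h3 : (h a - (v + s * (a - c))) * (a₂ - c) ≤ 0 := by linarith
    by_contra hcon
    push Not at hcon
    have := mul_pos (sub_pos.2 hcon) h2
    linarith
  have hs1 : h b₁ = v + s * (b₁ - c) := by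
    refine le_antisymm (hsL b₁ hb1) ?_
    have h2 := hpos b₂ hb2
    have h3 : (c - b₁) * h b₂ ≤ (c - b₁) * (v + s * (b₂ - c)) :=
      mul_le_mul_of_nonneg_left (hsU b₂ hb2) (by linarith [((mL b₁).1 hb1).2])
    have h4 : 0 ≤ (h b₁ - (v + s * (b₁ - c))) * (b₂ - c) := by linarith
    by_contra hcon
    push Not at hcon
    have := mul_pos (sub_pos.2 hcon) h2
    linarith
  refine ⟨b₁, a₂, s, v - s * c, ((mL b₁).1 hb1).1, ((mU a₂).1 ha2).1, ((mL b₁).1 hb1).2,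
    ((mU a₂).1 ha2).2, by rw [hs1]; ring, by rw [hs2]; ring, fun a ha => ?_⟩
  rcases le_or_gt (a : ℝ) c with hle | hgt
  · linarith [hsL a ((mL a).2 ⟨ha, hle⟩)]
  · linarith [hsU a ((mU a).2 ⟨ha, hgt⟩)]

theorem limLCS_le_linear {N : ℕ} {l p q : ℝ} (hl : 0 < l)
    (h : ∀ a b : ℕ, a + b = N → ecs a b ≤ p * a + q * b) (T m n : ℕ) (hmn : m + n = T * N) :
    limLCS m n ≤ p * m + q * n + T * (1 + Real.log (N + 1) / l + l * N / 8) := by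
  refine limLCS_le_of_forall fun k => ?_
  have := ecs_le_linear hl h (k * T) (k * m) (k * n) (by rw [← mul_add, hmn, mul_assoc])
  push_cast at this
  linarith

/-- One step of the recursion for the rate of convergence. Two words whose mean LCS lies on a
supporting line at total length `N` are repeated so that they fill the words of lengths `m`, `n`
up to a remainder of total length at most `N`. On the remainder the limit is at least the value
of the supporting line, so that the error there is bounded by the error at the scale `N`. -/
theorem limLCS_le_ecs_add {N R m n : ℕ} {l B : ℝ} (hl : 0 < l) (hN : 0 < N) (hR : 0 < R)
    (hmn : m + n = R * N) (hn : 0 < n)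
    (hB : ∀ a b : ℕ, a + b ≤ N → limLCS a b ≤ ecs a b + B) :
    limLCS m n ≤ ecs m n + R * (1 + Real.log (N + 1) / l + l * N / 8) + B := by
  have hR' : (0 : ℝ) < R := by exact_mod_cast hR
  have hN' : (0 : ℝ) < N := by exact_mod_cast hN
  have hmn' : (m : ℝ) + n = R * N := by exact_mod_cast hmn
  obtain ⟨a₁, a₂, s, t, ha₁, ha₂, h1, h2, e1, e2, hline⟩ :=
    exists_supporting_line (fun a => ecs a (N - a)) N (m / R) (by positivity) (by
      rw [div_lt_iff₀ hR']
      have : (0 : ℝ) < n := by exact_mod_cast hn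
      linarith)
  rw [le_div_iff₀ hR'] at h1
  rw [div_lt_iff₀ hR'] at h2
  have h1' : a₁ * R ≤ m := by exact_mod_cast h1
  have h2' : m < a₂ * R := by exact_mod_cast h2
  obtain ⟨b₁, hb₁⟩ : ∃ b₁, a₁ + b₁ = N := ⟨N - a₁, by omega⟩
  obtain ⟨b₂, hb₂⟩ : ∃ b₂, a₂ + b₂ = N := ⟨N - a₂, by omega⟩
  rw [show N - a₁ = b₁ by omega] at e1
  rw [show N - a₂ = b₂ by omega] at e2
  obtain ⟨D, hD⟩ : ∃ D, a₂ = a₁ + D := ⟨a₂ - a₁, by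
    have : a₁ < a₂ := lt_of_mul_lt_mul_right (h1'.trans_lt h2') (Nat.zero_le _)
    omega⟩
  have hD0 : 0 < D := by
    have : a₁ < a₂ := lt_of_mul_lt_mul_right (h1'.trans_lt h2') (Nat.zero_le _)
    omega
  have hD' : (0 : ℝ) < D := by exact_mod_cast hD0
  -- `D (m, n) = p₁ (a₁, b₁) + p₂ (a₂, b₂)`
  obtain ⟨p₁, hp₁⟩ : ∃ p₁, m + p₁ = a₂ * R := ⟨a₂ * R - m, by omega⟩
  obtain ⟨p₂, hp₂⟩ : ∃ p₂, a₁ * R + p₂ = m := ⟨m - a₁ * R, by omega⟩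
  have hp : p₁ + p₂ = D * R := by
    subst hD
    have : (a₁ + D) * R = a₁ * R + D * R := add_mul _ _ _
    omega
  have hm : p₁ * a₁ + p₂ * a₂ = D * m := by
    zify at hp hp₂ hD ⊢
    linear_combination (a₁ : ℤ) * hp + D * hp₂ + p₂ * hD
  have hn2 : p₁ * b₁ + p₂ * b₂ = D * n := by
    have e3 : p₁ * (a₁ + b₁) + p₂ * (a₂ + b₂) = D * (m + n) := by
      rw [hb₁, hb₂, hmn, ← add_mul, hp, mul_assoc]
    simp only [mul_add] at e3
    omega
  set q₁ := p₁ / D with hq₁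
  set q₂ := p₂ / D with hq₂
  set r₁ := p₁ % D with hr₁
  set r₂ := p₂ % D with hr₂
  have hd₁ : D * q₁ + r₁ = p₁ := Nat.div_add_mod p₁ D
  have hd₂ : D * q₂ + r₂ = p₂ := Nat.div_add_mod p₂ D
  have hr₁D : r₁ < D := Nat.mod_lt _ hD0
  have hr₂D : r₂ < D := Nat.mod_lt _ hD0
  have hqm : q₁ * a₁ + q₂ * a₂ ≤ m := by
    refine le_of_mul_le_mul_left ?_ hD0
    rw [← hm, ← hd₁, ← hd₂]
    have : D * (q₁ * a₁ + q₂ * a₂) + (r₁ * a₁ + r₂ * a₂) =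
      (D * q₁ + r₁) * a₁ + (D * q₂ + r₂) * a₂ := by ring
    omega
  have hqn : q₁ * b₁ + q₂ * b₂ ≤ n := by
    refine le_of_mul_le_mul_left ?_ hD0
    rw [← hn2, ← hd₁, ← hd₂]
    have : D * (q₁ * b₁ + q₂ * b₂) + (r₁ * b₁ + r₂ * b₂) =
      (D * q₁ + r₁) * b₁ + (D * q₂ + r₂) * b₂ := by ring
    omega
  obtain ⟨x, hx⟩ := Nat.exists_eq_add_of_le hqm
  obtain ⟨y, hy⟩ := Nat.exists_eq_add_of_le hqn
  have hDx : D * x = r₁ * a₁ + r₂ * a₂ := by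
    have e3 : (D * q₁ + r₁) * a₁ + (D * q₂ + r₂) * a₂ = D * (q₁ * a₁ + q₂ * a₂ + x) := by
      rw [hd₁, hd₂, ← hx, hm]
    linarith
  have hDy : D * y = r₁ * b₁ + r₂ * b₂ := by
    have e3 : (D * q₁ + r₁) * b₁ + (D * q₂ + r₂) * b₂ = D * (q₁ * b₁ + q₂ * b₂ + y) := by
      rw [hd₁, hd₂, ← hy, hn2]
    linarith
  -- the remainder has total length `0` or `N`
  have hxy : x + y ≤ N := by
    have e3 : D * (x + y) = (r₁ + r₂) * N := by
      rw [mul_add, hDx, hDy]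
      calc _ = r₁ * (a₁ + b₁) + r₂ * (a₂ + b₂) := by ring
        _ = _ := by rw [hb₁, hb₂]; ring
    obtain ⟨j, hj⟩ : ∃ j, r₁ + r₂ = D * j := by
      have h3 : D ∣ r₁ + r₂ := by
        rw [← Nat.dvd_add_right (dvd_mul_right D (q₁ + q₂))]
        refine ⟨R, ?_⟩
        rw [← hp, ← hd₁, ← hd₂]
        ring
      exact h3
    have hj2 : j < 2 := by
      refine lt_of_mul_lt_mul_left (a := D) ?_ (Nat.zero_le _)
      omega
    rw [hj, mul_assoc] at e3
    have e4 := Nat.eq_of_mul_eq_mul_left hD0 e3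
    rw [e4]
    calc j * N ≤ 1 * N := Nat.mul_le_mul_right N (by omega)
      _ = N := one_mul N
  set P : ℝ := t / N + s with hP
  set Q : ℝ := t / N with hQ
  have hQN : Q * N = t := div_mul_cancel₀ t hN'.ne'
  have hval : ∀ a b : ℕ, a + b = N → t + s * a = P * a + Q * b := by
    intro a b hab
    have : (a : ℝ) + b = N := by exact_mod_cast hab
    rw [← hQN, ← this]
    simp only [hP]
    ring
  have hdom : ∀ a b : ℕ, a + b = N → ecs a b ≤ P * a + Q * b := by
    intro a b hab
    rw [← hval a b hab]
    have := hline a (by omega)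
    simpa only [show N - a = b by omega] using this
  have e1' : ecs a₁ b₁ = P * a₁ + Q * b₁ := by rw [← hval a₁ b₁ hb₁]; exact e1
  have e2' : ecs a₂ b₂ = P * a₂ + Q * b₂ := by rw [← hval a₂ b₂ hb₂]; exact e2
  have hup := limLCS_le_linear hl hdom R m n hmn
  have hleft : P * x + Q * y ≤ limLCS x y := by
    have e3 : limLCS (D * x) (D * y) = D * limLCS x y := limLCS_mul D x y
    have e4 := limLCS_superadd (r₁ * a₁) (r₁ * b₁) (r₂ * a₂) (r₂ * b₂)
    rw [← hDx, ← hDy, e3] at e4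
    have e5 := (ecs_mul_ge r₁ a₁ b₁).trans (ecs_le_limLCS _ _)
    have e6 := (ecs_mul_ge r₂ a₂ b₂).trans (ecs_le_limLCS _ _)
    rw [e1'] at e5
    rw [e2'] at e6
    have hDx' : (D : ℝ) * x = r₁ * a₁ + r₂ * a₂ := by exact_mod_cast hDx
    have hDy' : (D : ℝ) * y = r₁ * b₁ + r₂ * b₂ := by exact_mod_cast hDy
    refine le_of_mul_le_mul_left ?_ hD'
    calc (D : ℝ) * (P * x + Q * y) = P * (D * x) + Q * (D * y) := by ring
      _ = r₁ * (P * a₁ + Q * b₁) + r₂ * (P * a₂ + Q * b₂) := by rw [hDx', hDy']; ring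
      _ ≤ _ := by linarith
  have hlow : q₁ * (P * a₁ + Q * b₁) + q₂ * (P * a₂ + Q * b₂) + ecs x y ≤ ecs m n := by
    have e4 := ecs_superadd (q₁ * a₁) (q₁ * b₁) (q₂ * a₂) (q₂ * b₂)
    have e5 := ecs_superadd (q₁ * a₁ + q₂ * a₂) (q₁ * b₁ + q₂ * b₂) x y
    rw [← hx, ← hy] at e5
    have e6 := ecs_mul_ge q₁ a₁ b₁
    have e7 := ecs_mul_ge q₂ a₂ b₂
    rw [e1'] at e6
    rw [e2'] at e7
    linarith
  have hBxy := hB x y hxy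
  have hx' : (m : ℝ) = q₁ * a₁ + q₂ * a₂ + x := by exact_mod_cast hx
  have hy' : (n : ℝ) = q₁ * b₁ + q₂ * b₂ + y := by exact_mod_cast hy
  have : P * m + Q * n = q₁ * (P * a₁ + Q * b₁) + q₂ * (P * a₂ + Q * b₂) + (P * x + Q * y) := by
    rw [hx', hy']; ring
  linarith

/-- The mean LCS converges at the rate `(m + n) ^ θ` for every `θ > 1 / 2`. -/
theorem exists_rate (θ : ℝ) (hθ : 1 / 2 < θ) :
    ∃ C : ℝ, 0 < C ∧ ∀ m n : ℕ, limLCS m n ≤ ecs m n + C * ((m : ℝ) + n) ^ θ := by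
  set η := θ - 1 / 2 with hη
  have hη0 : 0 < η := by linarith
  set c₀ : ℝ := 1 + 2 ^ η / η + 1 / 8 with hc₀
  have hc₀pos : 0 < c₀ := by positivity
  have hcN : ∀ N : ℕ, 0 < N → 1 + Real.log (N + 1) / (1 / √(N : ℝ)) + 1 / √(N : ℝ) * N / 8 ≤
      c₀ * (N : ℝ) ^ θ := by
    intro N hN
    have hN1 : (1 : ℝ) ≤ N := by exact_mod_cast hN
    have hsq : √(N : ℝ) = (N : ℝ) ^ (1 / 2 : ℝ) := Real.sqrt_eq_rpow _
    have hs0 : 0 < √(N : ℝ) := Real.sqrt_pos.2 (by linarith)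
    have e1 : (1 : ℝ) ≤ (N : ℝ) ^ θ := Real.one_le_rpow hN1 (by linarith)
    have e2 : √(N : ℝ) ≤ (N : ℝ) ^ θ := by
      rw [hsq]
      exact Real.rpow_le_rpow_of_exponent_le hN1 hθ.le
    have e3 : Real.log (N + 1) ≤ 2 ^ η / η * (N : ℝ) ^ η := by
      calc Real.log (N + 1) ≤ Real.log (2 * N) := Real.log_le_log (by linarith) (by linarith)
        _ ≤ (2 * (N : ℝ)) ^ η / η := Real.log_le_rpow_div (by linarith) hη0
        _ = _ := by rw [Real.mul_rpow (by norm_num) (by linarith)]; ring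
    have e4 : (N : ℝ) ^ η * √(N : ℝ) = (N : ℝ) ^ θ := by
      rw [hsq, ← Real.rpow_add (by linarith)]
      congr 1
      rw [hη]; ring
    have e5 : Real.log (N + 1) / (1 / √(N : ℝ)) ≤ 2 ^ η / η * (N : ℝ) ^ θ := by
      rw [div_div_eq_mul_div, div_one, ← e4, ← mul_assoc]
      gcongr
    have e6 : 1 / √(N : ℝ) * N / 8 ≤ 1 / 8 * (N : ℝ) ^ θ := by
      have : 1 / √(N : ℝ) * N = √(N : ℝ) := by
        field_simp
        exact (Real.sq_sqrt (by linarith)).symm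
      rw [this]
      linarith
    rw [hc₀]
    linarith
  set C : ℝ := 2 * (4 + 4 * c₀) with hC
  have hCpos : 0 < C := by positivity
  refine ⟨C, hCpos, ?_⟩
  have main : ∀ M m n : ℕ, m + n = M → limLCS m n ≤ ecs m n + C * (M : ℝ) ^ θ := by
    intro M
    induction M using Nat.strong_induction_on with
    | _ M ih =>
      intro m n hmn
      rcases Nat.eq_zero_or_pos M with rfl | hM
      · have hm : m = 0 := by omega
        have h1 := limLCS_le_left m n
        rw [hm, Nat.cast_zero] at h1
        have h2 := ecs_nonneg m n
        rw [hm] at h2 ⊢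
        have : 0 ≤ C * ((0 : ℕ) : ℝ) ^ θ := by positivity
        linarith
      have hM1 : (1 : ℝ) ≤ M := by exact_mod_cast hM
      have hMθ : (1 : ℝ) ≤ (M : ℝ) ^ θ := Real.one_le_rpow hM1 (by linarith)
      rcases lt_or_ge M 4 with hM4 | hM4
      · have h1 := limLCS_le_left m n
        have h2 := ecs_nonneg m n
        have h3 : (m : ℝ) ≤ 4 := by exact_mod_cast (by omega : m ≤ 4)
        have : C * 1 ≤ C * (M : ℝ) ^ θ := by gcongr
        linarith
      -- shorten the words to total length `4 N` with `N = ⌊M / 4⌋`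
      obtain ⟨N, r, hr, hMN⟩ : ∃ N r, r ≤ 3 ∧ M = 4 * N + r :=
        ⟨M / 4, M % 4, by omega, by omega⟩
      have hN : 0 < N := by omega
      obtain ⟨m', n', i, j, hm', hn', hij⟩ : ∃ m' n' i j, m = m' + i ∧ n = n' + j ∧ i + j = r := by
        rcases le_total r m with h | h
        · exact ⟨m - r, n, r, 0, by omega, by omega, by omega⟩
        · exact ⟨0, n - (r - m), m, r - m, by omega, by omega, by omega⟩
      have hNM : (N : ℝ) ≤ M / 4 := by
        have : 4 * N ≤ M := by omega
        have : (4 : ℝ) * N ≤ M := by exact_mod_cast this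
        linarith
      have hhalf : (N : ℝ) ^ θ ≤ (M : ℝ) ^ θ / 2 := by
        calc (N : ℝ) ^ θ ≤ ((M : ℝ) / 4) ^ θ := by gcongr
          _ = (M : ℝ) ^ θ * (1 / 4 : ℝ) ^ θ := by
              rw [← Real.mul_rpow (by linarith) (by norm_num)]; congr 1; ring
          _ ≤ (M : ℝ) ^ θ * (1 / 2) := by
              gcongr
              calc (1 / 4 : ℝ) ^ θ ≤ (1 / 4 : ℝ) ^ (1 / 2 : ℝ) :=
                    Real.rpow_le_rpow_of_exponent_ge (by norm_num) (by norm_num) hθ.le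
                _ = 1 / 2 := by
                    rw [← Real.sqrt_eq_rpow, show (1 / 4 : ℝ) = (1 / 2) ^ 2 by norm_num,
                      Real.sqrt_sq (by norm_num)]
          _ = _ := by ring
      have hstep : limLCS m' n' ≤ ecs m' n' + 4 * (c₀ * (N : ℝ) ^ θ) + C * (N : ℝ) ^ θ := by
        rcases Nat.eq_zero_or_pos n' with hn0 | hn0
        · have h1 := limLCS_le_left n' m'
          rw [limLCS_comm, hn0, Nat.cast_zero] at h1
          have h2 := ecs_nonneg m' n'
          rw [hn0] at h2 ⊢
          have : 0 ≤ 4 * (c₀ * (N : ℝ) ^ θ) + C * (N : ℝ) ^ θ := by positivity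
          linarith
        · have := limLCS_le_ecs_add (l := 1 / √(N : ℝ)) (B := C * (N : ℝ) ^ θ) (N := N) (R := 4)
            (m := m') (n := n') (by
              have : (0 : ℝ) < N := by exact_mod_cast hN
              positivity) hN (by norm_num) (by omega) hn0 (by
              intro a b hab
              have h1 := ih (a + b) (by omega) a b rfl
              have h2 : C * ((a + b : ℕ) : ℝ) ^ θ ≤ C * (N : ℝ) ^ θ := by
                gcongr
              linarith)
          have h2 := hcN N hN
          push_cast at this
          linarith
      have h1 := limLCS_add_le m' n' i j
      have h2 : ecs m' n' ≤ ecs m n := ecs_mono (by omega) (by omega)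
      rw [← hm', ← hn'] at h1
      have h3 : (i : ℝ) + j ≤ 3 := by exact_mod_cast (by omega : i + j ≤ 3)
      have h4 : c₀ * (N : ℝ) ^ θ ≤ c₀ * ((M : ℝ) ^ θ / 2) := by gcongr
      have h5 : C * (N : ℝ) ^ θ ≤ C * ((M : ℝ) ^ θ / 2) := by gcongr
      have h6 : C * ((M : ℝ) ^ θ / 2) = (4 + 4 * c₀) * (M : ℝ) ^ θ := by rw [hC]; ring
      have h7 : C * (M : ℝ) ^ θ = 2 * ((4 + 4 * c₀) * (M : ℝ) ^ θ) := by rw [hC]; ring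
      have h8 : 0 ≤ c₀ * (M : ℝ) ^ θ := by positivity
      nlinarith
  intro m n
  have := main (m + n) m n rfl
  push_cast at this
  exact this

/-! ### The mean LCS function near equal lengths -/

theorem le_nearestPos_add (x : ℝ) : x ≤ nearestPos x + 1 / 2 := by
  have h1 : x ≤ round x + 1 / 2 := by
    have := (abs_le.1 (abs_sub_round x)).2
    linarith
  have h2 : (round x : ℝ) ≤ ((round x).toNat : ℝ) := by exact_mod_cast Int.self_le_toNat (round x)
  have h3 : ((round x).toNat : ℝ) ≤ nearestPos x := by exact_mod_cast le_max_right _ _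
  linarith

theorem nearestPos_le_add {x : ℝ} (hx : 0 ≤ x) : (nearestPos x : ℝ) ≤ x + 1 := by
  unfold nearestPos
  rw [Nat.cast_max]
  apply max_le
  · simpa using hx
  · have h0 : 0 ≤ round x := by
      rw [round_eq]
      exact Int.floor_nonneg.2 (by linarith)
    have h1 : ((round x).toNat : ℝ) = round x := by exact_mod_cast Int.toNat_of_nonneg h0
    have := (abs_le.1 (abs_sub_round x)).1
    rw [h1]
    linarith

theorem nearestPos_pos (x : ℝ) : 1 ≤ nearestPos x := le_max_left _ _

theorem nearestPos_le_of_le {x : ℝ} {m : ℕ} (hm : 1 ≤ m) (h : x ≤ m) : nearestPos x ≤ m := by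
  refine max_le hm (Int.toNat_le.2 ?_)
  rw [round_eq]
  refine Int.lt_add_one_iff.1 (Int.floor_lt.2 ?_)
  push_cast
  linarith

theorem nearestPos_natCast {n : ℕ} (hn : 1 ≤ n) : nearestPos n = n := by
  unfold nearestPos
  rw [round_natCast]
  simpa using hn

theorem gammaFin_two (n : ℕ) (p : ℝ) : gammaFin 2 n p =
    ecs (nearestPos ((n : ℝ) - n * p)) (nearestPos ((n : ℝ) + n * p)) / n := by
  rw [gammaFin, meanLCS_two]

/-- The limit in the definition of the mean LCS function exists. -/
theorem tendsto_gammaFin {p : ℝ} (hp : p ∈ Set.Ioo (-1 : ℝ) 1) :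
    Tendsto (fun n => gammaFin 2 n p) atTop (𝓝 (gammaFun 2 p)) := by
  obtain ⟨hp1, hp2⟩ := hp
  suffices h : ∃ L, Tendsto (fun n => gammaFin 2 n p) atTop (𝓝 L) from tendsto_nhds_limUnder h
  set a : ℕ → ℕ := fun n => nearestPos ((n : ℝ) - n * p) with ha
  set b : ℕ → ℕ := fun n => nearestPos ((n : ℝ) + n * p) with hb
  have hm : ∀ n : ℕ, 0 ≤ (n : ℝ) - n * p := fun n => by
    have : (0 : ℝ) ≤ n := n.cast_nonneg
    nlinarith
  have hpl : ∀ n : ℕ, 0 ≤ (n : ℝ) + n * p := fun n => by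
    have : (0 : ℝ) ≤ n := n.cast_nonneg
    nlinarith
  have hsub : ∀ m n : ℕ, a m + a n ≤ a (m + n) + 3 ∧ b m + b n ≤ b (m + n) + 3 := by
    intro m n
    have h1 := nearestPos_le_add (hm m)
    have h2 := nearestPos_le_add (hm n)
    have h3 := le_nearestPos_add (((m + n : ℕ) : ℝ) - (m + n : ℕ) * p)
    have h4 := nearestPos_le_add (hpl m)
    have h5 := nearestPos_le_add (hpl n)
    have h6 := le_nearestPos_add (((m + n : ℕ) : ℝ) + (m + n : ℕ) * p)
    constructor
    · have : (a m : ℝ) + a n ≤ a (m + n) + 3 := by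
        simp only [ha]
        push_cast at h3 ⊢
        linarith
      exact_mod_cast this
    · have : (b m : ℝ) + b n ≤ b (m + n) + 3 := by
        simp only [hb]
        push_cast at h6 ⊢
        linarith
      exact_mod_cast this
  have hv : Subadditive fun n : ℕ => 6 - ecs (a n) (b n) := by
    intro m n
    have h1 := ecs_superadd (a m) (b m) (a n) (b n)
    have h2 := ecs_mono (hsub m n).1 (hsub m n).2
    have h3 := ecs_add_le (a (m + n)) (b (m + n)) 3 3
    push_cast at h3
    linarith
  have hbdd : BddBelow (Set.range fun n : ℕ => (6 - ecs (a n) (b n)) / n) := by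
    refine ⟨-3, ?_⟩
    rintro _ ⟨n, rfl⟩
    rcases Nat.eq_zero_or_pos n with rfl | hn
    · simp
    · have hn' : (1 : ℝ) ≤ n := by exact_mod_cast hn
      have h := ecs_le_left (a n) (b n)
      have h2 := nearestPos_le_add (hm n)
      dsimp only
      rw [le_div_iff₀ (by linarith)]
      have : (a n : ℝ) ≤ n - n * p + 1 := h2
      nlinarith
  have hlim := hv.tendsto_lim hbdd
  have h6 : Tendsto (fun n : ℕ => (6 : ℝ) / n) atTop (𝓝 0) :=
    tendsto_const_div_atTop_nhds_zero_nat 6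
  refine ⟨_, (h6.sub hlim).congr fun n => ?_⟩
  rw [gammaFin_two, ← sub_div]
  simp [ha, hb]

theorem gammaFun_zero : gammaFun 2 0 = gammaStar 2 := by
  refine tendsto_nhds_unique (tendsto_gammaFin (by norm_num)) ?_
  rw [gammaStar_two]
  refine (tendsto_ecs_div 1 1).congr' ?_
  filter_upwards [eventually_gt_atTop 0] with n hn
  rw [gammaFin_two]
  simp [nearestPos_natCast hn]

theorem gammaFun_le {p : ℝ} (hp : p ∈ Set.Ioo (-1 : ℝ) 1) : gammaFun 2 p ≤ gammaFun 2 0 := by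
  rw [gammaFun_zero]
  have h : Tendsto (fun n : ℕ => gammaStar 2 + gammaStar 2 / n) atTop (𝓝 (gammaStar 2 + 0)) :=
    (tendsto_const_div_atTop_nhds_zero_nat _).const_add _
  rw [add_zero] at h
  refine le_of_tendsto_of_tendsto (tendsto_gammaFin hp) h ?_
  filter_upwards [eventually_gt_atTop 0] with n hn
  have hn' : (0 : ℝ) < n := by exact_mod_cast hn
  rw [gammaFin_two, div_le_iff₀ hn', add_mul, div_mul_cancel₀ _ hn'.ne']
  refine (ecs_le _ _).trans ?_
  have h1 := nearestPos_le_add (x := (n : ℝ) - n * p) (by nlinarith [hp.2])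
  have h2 := nearestPos_le_add (x := (n : ℝ) + n * p) (by nlinarith [hp.1])
  have h3 : ((nearestPos ((n : ℝ) - n * p) : ℝ) + nearestPos ((n : ℝ) + n * p)) ≤ 2 * n + 2 := by
    linarith
  nlinarith [gammaStar_nonneg]

/-- The mean LCS function has points close to its maximum, relative to their distance from the
origin. A positive maximiser is such a point, with no loss at all; without one, `pMax 2 = 0`, and
the derivative there vanishes. -/
theorem exists_gammaFun_ge (hdiff : DifferentiableAt ℝ (gammaFun 2) (pMax 2)) {ε : ℝ}
    (hε : 0 < ε) : ∃ δ, 0 < δ ∧ δ < 1 ∧ gammaStar 2 - ε * δ ≤ gammaFun 2 δ := by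
  rw [← gammaFun_zero]
  set S := {p : ℝ | p ∈ Set.Ioo (-1 : ℝ) 1 ∧ IsMaxOn (gammaFun 2) (Set.Ioo (-1 : ℝ) 1) p} with hS
  have h0 : (0 : ℝ) ∈ S := ⟨by norm_num, fun p hp => gammaFun_le hp⟩
  by_cases hq : ∃ q ∈ S, 0 < q
  · obtain ⟨q, ⟨hq1, hq2⟩, hq0⟩ := hq
    refine ⟨q, hq0, hq1.2, ?_⟩
    have : gammaFun 2 0 ≤ gammaFun 2 q := hq2 (by norm_num : (0 : ℝ) ∈ Set.Ioo (-1 : ℝ) 1)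
    nlinarith
  · push Not at hq
    have hpM : pMax 2 = 0 := IsGreatest.csSup_eq ⟨h0, fun q hq' => hq q hq'⟩
    rw [hpM] at hdiff
    have hmax : IsLocalMax (gammaFun 2) 0 :=
      h0.2.isLocalMax (Ioo_mem_nhds (by norm_num) (by norm_num))
    have hd := hdiff.hasDerivAt
    rw [hmax.deriv_eq_zero] at hd
    have ho := (hasDerivAt_iff_isLittleO.1 hd).def hε
    have h1 : ∀ᶠ p in 𝓝[>] (0 : ℝ), p < 1 :=
      nhdsWithin_le_nhds (Iio_mem_nhds (by norm_num))
    have h2 : ∀ᶠ p in 𝓝[>] (0 : ℝ),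
        ‖gammaFun 2 p - gammaFun 2 0 - (p - 0) • (0 : ℝ)‖ ≤ ε * ‖p - 0‖ := nhdsWithin_le_nhds ho
    obtain ⟨δ, ⟨hδ1, hδ2⟩, hδ0⟩ := ((h2.and h1).and self_mem_nhdsWithin).exists
    refine ⟨δ, hδ0, hδ2, ?_⟩
    have hδ0' : (0 : ℝ) < δ := hδ0
    simp only [sub_zero, smul_zero, Real.norm_eq_abs, abs_of_pos hδ0'] at hδ1
    linarith [(abs_le.1 hδ1).1]

/-- Slightly shortening one of two words of equal length costs, to first order, at most half the
limiting rate for each letter. -/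
theorem exists_limLCS_ge (hdiff : DifferentiableAt ℝ (gammaFun 2) (pMax 2)) {ε : ℝ}
    (hε : 0 < ε) : ∃ δ, 0 < δ ∧ δ < 1 ∧ ∀ᶠ m : ℕ in atTop, ∃ n₀ : ℕ, (n₀ : ℝ) ≤ (1 - δ) * m ∧
      gammaStar 2 * (m + n₀) / 2 - ε * δ * m ≤ limLCS m n₀ := by
  obtain ⟨δ, hδ0, hδ1, hδ⟩ := exists_gammaFun_ge hdiff (show 0 < ε / 3 by positivity)
  refine ⟨δ, hδ0, hδ1, ?_⟩
  have hlim := tendsto_gammaFin (p := δ) ⟨by linarith, hδ1⟩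
  have hev : ∀ᶠ n : ℕ in atTop, gammaStar 2 - 2 * (ε / 3) * δ < gammaFin 2 n δ := by
    refine hlim.eventually (lt_mem_nhds ?_)
    have : 0 < ε / 3 * δ := by positivity
    linarith
  have htend : Tendsto (fun m : ℕ => ⌊(m : ℝ) / (1 + δ)⌋₊) atTop atTop :=
    tendsto_nat_floor_atTop.comp
      (tendsto_natCast_atTop_atTop.atTop_div_const (by linarith : (0 : ℝ) < 1 + δ))
  have hκ : 0 < δ * (1 - δ) / (1 + δ) := by
    have : 0 < 1 - δ := by linarith
    positivity
  have hg := gammaStar_nonneg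
  have big1 : ∀ᶠ m : ℕ in atTop, 1 / (δ * (1 - δ) / (1 + δ)) ≤ (m : ℝ) :=
    tendsto_natCast_atTop_atTop.eventually_ge_atTop _
  have big2 : ∀ᶠ m : ℕ in atTop, 3 / 2 * gammaStar 2 / (ε / 3 * δ) ≤ (m : ℝ) :=
    tendsto_natCast_atTop_atTop.eventually_ge_atTop _
  filter_upwards [htend.eventually hev, htend.eventually (eventually_gt_atTop 0), big1, big2,
    eventually_gt_atTop 0] with m h1 h2 h3 h4 hm
  set n := ⌊(m : ℝ) / (1 + δ)⌋₊ with hn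
  have hn' : (0 : ℝ) < n := by exact_mod_cast h2
  have hm0 : (0 : ℝ) ≤ m := m.cast_nonneg
  have hle : (n : ℝ) * (1 + δ) ≤ m := by
    rw [← le_div_iff₀ (by linarith)]
    exact Nat.floor_le (by positivity)
  have hlt : (m : ℝ) ≤ (n + 1) * (1 + δ) := by
    rw [← div_le_iff₀ (by linarith)]
    exact (Nat.lt_floor_add_one _).le
  rw [gammaFin_two, lt_div_iff₀ hn'] at h1
  rw [div_le_iff₀ hκ] at h3
  rw [div_le_iff₀ (by positivity)] at h4
  refine ⟨nearestPos ((n : ℝ) - n * δ), ?_, ?_⟩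
  · have h5 := nearestPos_le_add (x := (n : ℝ) - n * δ) (by nlinarith)
    have h6 : (n : ℝ) * (1 - δ) ≤ m / (1 + δ) * (1 - δ) := by
      refine mul_le_mul_of_nonneg_right ?_ (by linarith)
      rwa [le_div_iff₀ (by linarith)]
    have h7 : (m : ℝ) / (1 + δ) * (1 - δ) + m * (δ * (1 - δ) / (1 + δ)) = (1 - δ) * m := by
      field_simp
    linarith
  · have h5 : ecs (nearestPos ((n : ℝ) - n * δ)) (nearestPos ((n : ℝ) + n * δ)) ≤
        limLCS m (nearestPos ((n : ℝ) - n * δ)) := by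
      rw [ecs_comm]
      exact (ecs_mono (nearestPos_le_of_le hm (by linarith)) le_rfl).trans (ecs_le_limLCS _ _)
    have h6 := nearestPos_le_add (x := (n : ℝ) - n * δ) (by nlinarith)
    have h7 : gammaStar 2 * (m + nearestPos ((n : ℝ) - n * δ)) / 2 ≤
        gammaStar 2 * n + 3 / 2 * gammaStar 2 := by
      have : (m : ℝ) + nearestPos ((n : ℝ) - n * δ) ≤ 2 * n + 3 := by linarith
      nlinarith
    have h8 : (n : ℝ) ≤ m := by nlinarith
    have h9 : 0 ≤ ε / 3 * δ := by positivity
    have h10 := mul_le_mul_of_nonneg_left h8 h9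
    nlinarith

/-- Taking `t` letters from a word that is not much shorter than the other one costs at most
`(γ* / 2 + ε) t`. -/
theorem limLCS_sub_le {m n n₀ t : ℕ} {ε δ : ℝ} (hε : 0 ≤ ε) (hδ : 0 < δ) (hm : 0 < m)
    (hn₀ : (n₀ : ℝ) ≤ (1 - δ) * m)
    (h : gammaStar 2 * (m + n₀) / 2 - ε * δ * m ≤ limLCS m n₀)
    (ht : t ≤ n) (hn : (1 - δ / 2) * m ≤ (n : ℝ) - t) :
    limLCS m n - limLCS m (n - t) ≤ t * (gammaStar 2 / 2 + 2 * ε) := by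
  have hm' : (0 : ℝ) < m := by exact_mod_cast hm
  have hδm : 0 < δ * m := by positivity
  have hlt : (n₀ : ℝ) ≤ n - t := by nlinarith
  have hlt' : n₀ + t ≤ n := by
    have : (n₀ : ℝ) + t ≤ n := by linarith
    exact_mod_cast this
  obtain ⟨s, hs⟩ := Nat.exists_eq_add_of_le hlt'
  have e1 := limLCS_superadd (s * m) (s * n) (t * m) (t * n₀)
  have e2 : s * m + t * m = (s + t) * m := (add_mul _ _ _).symm
  have e3 : s * n + t * n₀ = (s + t) * (n - t) := by
    rw [show n - t = n₀ + s by omega, hs]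
    ring
  rw [e2, e3, limLCS_mul, limLCS_mul, limLCS_mul] at e1
  have e4 := limLCS_le m n
  have hn' : (n : ℝ) = n₀ + t + s := by exact_mod_cast hs
  push_cast at e1
  have hst : δ * m / 2 ≤ (s : ℝ) + t := by nlinarith [(Nat.cast_nonneg t : (0 : ℝ) ≤ t)]
  have hst0 : (0 : ℝ) < (s : ℝ) + t := by linarith
  have ht0 : (0 : ℝ) ≤ t := Nat.cast_nonneg t
  refine le_of_mul_le_mul_left ?_ hst0
  have e5 : ((s : ℝ) + t) * (limLCS m n - limLCS m (n - t)) ≤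
      t * (limLCS m n - limLCS m n₀) := by linarith
  have e6 : limLCS m n - limLCS m n₀ ≤ ((s : ℝ) + t) * (gammaStar 2 / 2 + 2 * ε) := by
    have : ε * (δ * m) ≤ ε * (2 * (s + t)) := mul_le_mul_of_nonneg_left (by linarith) hε
    rw [hn'] at e4
    linarith
  calc _ ≤ _ := e5
    _ ≤ t * (((s : ℝ) + t) * (gammaStar 2 / 2 + 2 * ε)) := by gcongr
    _ = _ := by ring

/-! ### Strings with a constant block -/

/-- The string `x`, of length `2 d`, with its `2 h` middle letters replaced by `k` letters `a`. -/
def fillBlock (d h k : ℕ) (a : Fin 2) (x : List (Fin 2)) : List (Fin 2) :=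
  x.take (d - h) ++ (List.replicate k a ++ x.drop (d + h))

theorem fillBlock_ge (d h k : ℕ) (a : Fin 2) (x y₁ y₂ y₃ : List (Fin 2)) :
    lcs (x.take (d - h)) y₁ + (min k (y₂.count a) + lcs (x.drop (d + h)) y₃) ≤
      lcs (fillBlock d h k a x) (y₁ ++ (y₂ ++ y₃)) := by
  rw [← lcs_replicate]
  exact (Nat.add_le_add_left (lcs_append_le _ _ _ _) _).trans (lcs_append_le _ _ _ _)

theorem exists_fillBlock_eq (d h k : ℕ) (a : Fin 2) (x y : List (Fin 2)) :
    ∃ y₁ y₂ y₃, y = y₁ ++ (y₂ ++ y₃) ∧ lcs (fillBlock d h k a x) y =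
      lcs (x.take (d - h)) y₁ + (min k (y₂.count a) + lcs (x.drop (d + h)) y₃) := by
  obtain ⟨y₁, y', rfl, e1⟩ := exists_lcs_append (x.take (d - h))
    (List.replicate k a ++ x.drop (d + h)) y
  obtain ⟨y₂, y₃, rfl, e2⟩ := exists_lcs_append (List.replicate k a) (x.drop (d + h)) y'
  refine ⟨y₁, y₂, y₃, rfl, ?_⟩
  rw [← lcs_replicate, ← e2]
  exact e1

/-- All the quantities that govern an alignment of a string with a block deviate from their means
by less than `s`. -/
structure Typical (d h : ℕ) (s : ℝ) (x y : List (Fin 2)) : Prop where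
  left : ∀ i ≤ 2 * d, |(lcs (x.take (d - h)) (y.take i) : ℝ) - ecs (d - h) i| < s
  right : ∀ j ≤ 2 * d, |(lcs (x.drop (d + h)) (y.drop j) : ℝ) - ecs (d - h) (2 * d - j)| < s
  count : ∀ i ≤ 2 * d, ∀ q ≤ 2 * d, i + q ≤ 2 * d → ∀ a,
    |(((y.drop i).take q).count a : ℝ) - q / 2| < s
  whole : |(lcs x y : ℝ) - ecs (2 * d) (2 * d)| < s

theorem avg_count (n : ℕ) (a : Fin 2) : avg n (fun u => (u.count a : ℝ)) = n / 2 := by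
  induction n with
  | zero => simp [avg]
  | succ n ih =>
    simp only [avg, List.count_cons, Nat.cast_add, avg_add, avg_const, ih]
    fin_cases a <;> simp <;> ring

theorem bddDiff_count (a : Fin 2) : BddDiff fun u => (u.count a : ℝ) := by
  intro u v b c
  simp only [List.count_append, List.count_cons]
  push_cast
  rw [abs_le]
  constructor <;> split_ifs <;> norm_num

theorem wordProb_window {m n a b : ℕ} (f g : List (Fin 2) → List (Fin 2))
    (hf : ∀ G : List (Fin 2) → ℝ, avg m (fun x => G (f x)) = avg a G)
    (hg : ∀ G : List (Fin 2) → ℝ, avg n (fun y => G (g y)) = avg b G)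
    (Q : List (Fin 2) → List (Fin 2) → Prop) :
    wordProb m n (fun x y => Q (f x) (g y)) = wordProb a b Q := by
  classical
  unfold wordProb
  rw [← hf]
  refine avg_congr fun x _ => ?_
  rw [← hg]

theorem not_typical {d h : ℕ} {s : ℝ} {x y : List (Fin 2)} (H : ¬ Typical d h s x y) :
    ((∃ i ∈ Finset.range (2 * d + 1),
        s ≤ |(lcs (x.take (d - h)) (y.take i) : ℝ) - ecs (d - h) i|) ∨
      (∃ j ∈ Finset.range (2 * d + 1),
        s ≤ |(lcs (x.drop (d + h)) (y.drop j) : ℝ) - ecs (d - h) (2 * d - j)|)) ∨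
    ((∃ p ∈ ((Finset.range (2 * d + 1) ×ˢ Finset.range (2 * d + 1)).filter
        (fun p => p.1 + p.2 ≤ 2 * d)) ×ˢ (Finset.univ : Finset (Fin 2)),
        s ≤ |(((y.drop p.1.1).take p.1.2).count p.2 : ℝ) - (p.1.2 : ℕ) / 2|) ∨
      s ≤ |(lcs x y : ℝ) - ecs (2 * d) (2 * d)|) := by
  by_contra hcon
  push Not at hcon
  obtain ⟨⟨h1, h2⟩, h3, h4⟩ := hcon
  refine H ⟨fun i hi => h1 i (by simpa [Nat.lt_succ_iff] using hi),
    fun j hj => h2 j (by simpa [Nat.lt_succ_iff] using hj), fun i hi q hq hiq a => ?_, h4⟩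
  exact h3 ((i, q), a) (by
    simp only [Finset.mem_product, Finset.mem_filter, Finset.mem_range, Finset.mem_univ, and_true]
    exact ⟨⟨by omega, by omega⟩, hiq⟩)

theorem wordProb_not_typical_le {d h : ℕ} (hd : 1 ≤ d) (hh : h ≤ d) {s : ℝ} (hs : 0 ≤ s) :
    wordProb (2 * d) (2 * d) (fun x y => ¬ Typical d h s x y) ≤
      50 * (d : ℝ) ^ 2 * Real.exp (-(2 * s ^ 2 / (4 * d))) := by
  set E := 2 * Real.exp (-(2 * s ^ 2 / (4 * (d : ℝ)))) with hE
  have hd' : (1 : ℝ) ≤ d := by exact_mod_cast hd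
  have h4d : (0 : ℝ) < 4 * d := by linarith
  have hE0 : 0 ≤ E := by positivity
  have b1 : ∀ i ∈ Finset.range (2 * d + 1), wordProb (2 * d) (2 * d) (fun x y =>
      s ≤ |(lcs (x.take (d - h)) (y.take i) : ℝ) - ecs (d - h) i|) ≤ E := by
    intro i hi
    have hi' : i ≤ 2 * d := by simpa [Nat.lt_succ_iff] using hi
    rw [wordProb_window (fun x => x.take (d - h)) (fun y => y.take i)
      (avg_take (by omega)) (avg_take hi') (fun x y => s ≤ |(lcs x y : ℝ) - ecs (d - h) i|)]
    refine wordProb_abs_sub_le bddDiff_lcs_left bddDiff_lcs_right hs h4d ?_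
    exact_mod_cast (by omega : d - h + i ≤ 4 * d)
  have b2 : ∀ j ∈ Finset.range (2 * d + 1), wordProb (2 * d) (2 * d) (fun x y =>
      s ≤ |(lcs (x.drop (d + h)) (y.drop j) : ℝ) - ecs (d - h) (2 * d - j)|) ≤ E := by
    intro j hj
    have hj' : j ≤ 2 * d := by simpa [Nat.lt_succ_iff] using hj
    rw [wordProb_window (a := 2 * d - (d + h)) (fun x => x.drop (d + h)) (fun y => y.drop j)
      (avg_drop (by omega)) (avg_drop hj')
      (fun x y => s ≤ |(lcs x y : ℝ) - ecs (d - h) (2 * d - j)|),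
      show 2 * d - (d + h) = d - h by omega]
    refine wordProb_abs_sub_le bddDiff_lcs_left bddDiff_lcs_right hs h4d ?_
    exact_mod_cast (by omega : d - h + (2 * d - j) ≤ 4 * d)
  have b3 : ∀ p ∈ ((Finset.range (2 * d + 1) ×ˢ Finset.range (2 * d + 1)).filter
        (fun p => p.1 + p.2 ≤ 2 * d)) ×ˢ (Finset.univ : Finset (Fin 2)),
      wordProb (2 * d) (2 * d) (fun _ y =>
        s ≤ |(((y.drop p.1.1).take p.1.2).count p.2 : ℝ) - (p.1.2 : ℕ) / 2|) ≤ E := by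
    rintro ⟨⟨i, q⟩, a⟩ hp
    simp only [Finset.mem_product, Finset.mem_filter, Finset.mem_range] at hp
    dsimp only
    rw [wordProb_window (fun x => x) (fun y => (y.drop i).take q) (fun _ => rfl)
      (b := q) (fun G => by
        rw [avg_drop (by omega : i ≤ 2 * d) (fun u => G (u.take q)), avg_take (by omega)])
      (fun _ y => s ≤ |(y.count a : ℝ) - (q : ℕ) / 2|)]
    have := wordProb_abs_sub_le (g := fun _ y => (y.count a : ℝ)) (m := 2 * d) (n := q)
      (fun y u v b c => by simp) (fun _ => bddDiff_count a) hs h4d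
      (by exact_mod_cast (by omega : 2 * d + q ≤ 4 * d))
    simpa only [avg_count, avg_const] using this
  have b4 : wordProb (2 * d) (2 * d) (fun x y =>
      s ≤ |(lcs x y : ℝ) - ecs (2 * d) (2 * d)|) ≤ E := by
    refine wordProb_abs_sub_le bddDiff_lcs_left bddDiff_lcs_right hs h4d ?_
    exact_mod_cast (by omega : 2 * d + 2 * d ≤ 4 * d)
  have sum_le : ∀ {ι : Type} (S : Finset ι) (Q : ι → List (Fin 2) → List (Fin 2) → Prop),
      (∀ i ∈ S, wordProb (2 * d) (2 * d) (Q i) ≤ E) →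
      wordProb (2 * d) (2 * d) (fun x y => ∃ i ∈ S, Q i x y) ≤ S.card * E := by
    intro ι S Q hQ
    refine (wordProb_exists_le S _ _ Q).trans ?_
    rw [← nsmul_eq_mul]
    exact Finset.sum_le_card_nsmul _ _ _ hQ
  refine (wordProb_mono fun x y _ _ => not_typical).trans ?_
  refine (wordProb_or_le _ _ _ _).trans ?_
  refine (add_le_add ((wordProb_or_le _ _ _ _).trans (add_le_add (sum_le _ _ b1) (sum_le _ _ b2)))
    ((wordProb_or_le _ _ _ _).trans (add_le_add (sum_le _ _ b3) b4))).trans ?_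
  have hcard : ((((Finset.range (2 * d + 1) ×ˢ Finset.range (2 * d + 1)).filter
      (fun p => p.1 + p.2 ≤ 2 * d)) ×ˢ (Finset.univ : Finset (Fin 2))).card : ℝ) ≤
      (2 * d + 1) * (2 * d + 1) * 2 := by
    rw [Finset.card_product]
    have h1 := Finset.card_filter_le (Finset.range (2 * d + 1) ×ˢ Finset.range (2 * d + 1))
      (fun p => p.1 + p.2 ≤ 2 * d)
    rw [Finset.card_product, Finset.card_range] at h1
    rw [Finset.card_univ, Fintype.card_fin]
    exact_mod_cast Nat.mul_le_mul_right 2 h1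
  rw [Finset.card_range]
  push_cast
  have h5 : ((2 * (d : ℝ) + 1) * E + (2 * d + 1) * E) + ((2 * d + 1) * (2 * d + 1) * 2 * E + E) ≤
      25 * d ^ 2 * E := by
    have : (2 * (d : ℝ) + 1) + (2 * d + 1) + ((2 * d + 1) * (2 * d + 1) * 2 + 1) ≤ 25 * d ^ 2 := by
      nlinarith
    calc _ = ((2 * (d : ℝ) + 1) + (2 * d + 1) + ((2 * d + 1) * (2 * d + 1) * 2 + 1)) * E := by ring
      _ ≤ _ := by gcongr
  have h6 := mul_le_mul_of_nonneg_right hcard hE0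
  have h7 : 25 * (d : ℝ) ^ 2 * E = 50 * d ^ 2 * Real.exp (-(2 * s ^ 2 / (4 * d))) := by
    rw [hE]; ring
  linarith

/-- If the block is shortened by `m` letters, then in a typical situation the LCS decreases: one
of the two sides of the block can give up `2 m` letters of `y` at a cost less than `m`. -/
theorem Typical.lcs_fillBlock_lt {d h m : ℕ} {s K : ℝ} {x y : List (Fin 2)}
    (H : Typical d h s x y) (hy : y.length = 2 * d) (hm : 1 ≤ m) (hmh : m ≤ 2 * h)
    (hd : 2 * h + 2 * m ≤ d) (hs : s ≤ m)
    (hK : ∀ i, d - 2 * h ≤ i → i ≤ 2 * d → ecs (d - h) i - ecs (d - h) (i - 2 * m) ≤ K)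
    (hlt : K + 3 * s < m) (a : Fin 2) :
    lcs (fillBlock d h (2 * h - m) a x) y < lcs (fillBlock d h (2 * h) a x) y := by
  obtain ⟨y₁, y₂, y₃, rfl, e⟩ := exists_fillBlock_eq d h (2 * h - m) a x y
  simp only [List.length_append] at hy
  rw [e]
  -- if `y₂` has unused letters `a`, the longer block takes them up at no cost
  rcases lt_or_ge (2 * h - m) (y₂.count a) with hc | hc
  · have := fillBlock_ge d h (2 * h) a x y₁ y₂ y₃
    omega
  rw [min_eq_right hc]
  have hq : y₂.length < 4 * h := by
    have h1 := H.count y₁.length (by omega) y₂.length (by omega) (by omega) a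
    rw [List.drop_left, List.take_left] at h1
    have h2 : (y₂.count a : ℝ) ≤ 2 * h - m := by
      have : ((2 * h - m : ℕ) : ℝ) = 2 * h - m := by
        rw [Nat.cast_sub hmh]; push_cast; ring
      rw [← this]
      exact_mod_cast hc
    have h3 : (y₂.length : ℝ) < 4 * h := by linarith [(abs_lt.1 h1).1]
    exact_mod_cast h3
  have hcR : (y₂.count a : ℝ) + m ≤ 2 * h := by
    exact_mod_cast (by omega : y₂.count a + m ≤ 2 * h)
  -- otherwise `y₂` is short, so that one of `y₁` and `y₃` has at least `d - 2 h` letters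
  rcases le_or_gt (d - 2 * h) y₁.length with hi | hi
  · obtain ⟨u, v, rfl, hv⟩ : ∃ u v, y₁ = u ++ v ∧ v.length = 2 * m :=
      ⟨y₁.take (y₁.length - 2 * m), y₁.drop (y₁.length - 2 * m), (List.take_append_drop _ _).symm,
        by rw [List.length_drop]; omega⟩
    simp only [List.length_append] at hy hi
    have g1 := fillBlock_ge d h (2 * h) a x u (v ++ y₂) y₃
    simp only [List.append_assoc, List.count_append] at g1 ⊢
    have g2 := H.left (u.length + v.length) (by omega)
    have g3 := H.left u.length (by omega)
    have g4 := H.count u.length (by omega) v.length (by omega) (by omega) a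
    rw [List.append_assoc, List.drop_left, List.take_left] at g4
    rw [List.append_assoc, List.take_left] at g3
    rw [← List.length_append, List.take_left, List.length_append] at g2
    have g5 := hK (u.length + v.length) (by omega) (by omega)
    rw [show u.length + v.length - 2 * m = u.length by omega] at g5
    rw [hv] at g4
    push_cast at g4
    have g6 : (m : ℝ) - s + y₂.count a ≤ (min (2 * h) (v.count a + y₂.count a) : ℕ) := by
      rw [Nat.cast_min]
      push_cast
      apply le_min
      · linarith [(abs_lt.1 g3).1, abs_nonneg ((lcs (x.take (d - h)) u : ℝ) - ecs (d - h) u.length)]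
      · linarith [(abs_lt.1 g4).1]
    refine lt_of_lt_of_le ?_ g1
    have : (lcs (x.take (d - h)) (u ++ v) : ℝ) + (y₂.count a + lcs (x.drop (d + h)) y₃) <
        lcs (x.take (d - h)) u + ((min (2 * h) (v.count a + y₂.count a) : ℕ) +
          lcs (x.drop (d + h)) y₃) := by
      linarith [(abs_lt.1 g2).2, (abs_lt.1 g3).1]
    exact_mod_cast this
  · have hk : d - 2 * h ≤ y₃.length := by omega
    obtain ⟨u, v, rfl, hu⟩ : ∃ u v, y₃ = u ++ v ∧ u.length = 2 * m :=
      ⟨y₃.take (2 * m), y₃.drop (2 * m), (List.take_append_drop _ _).symm,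
        by rw [List.length_take]; omega⟩
    simp only [List.length_append] at hy hk
    have g1 := fillBlock_ge d h (2 * h) a x y₁ (y₂ ++ u) v
    simp only [List.append_assoc, List.count_append] at g1 ⊢
    have e1 : (y₁ ++ (y₂ ++ (u ++ v))).drop (y₁.length + y₂.length) = u ++ v := by
      rw [← List.append_assoc, ← List.length_append, List.drop_left]
    have e2 : (y₁ ++ (y₂ ++ (u ++ v))).drop (y₁.length + y₂.length + u.length) = v := by
      rw [← List.append_assoc, ← List.append_assoc, ← List.length_append, ← List.length_append,
        List.drop_left]
    have g2 := H.right (y₁.length + y₂.length) (by omega)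
    have g3 := H.right (y₁.length + y₂.length + u.length) (by omega)
    have g4 := H.count (y₁.length + y₂.length) (by omega) u.length (by omega) (by omega) a
    rw [e1, List.take_left] at g4
    rw [e1, show 2 * d - (y₁.length + y₂.length) = u.length + v.length by omega] at g2
    rw [e2, show 2 * d - (y₁.length + y₂.length + u.length) = v.length by omega] at g3
    have g5 := hK (u.length + v.length) (by omega) (by omega)
    rw [show u.length + v.length - 2 * m = v.length by omega] at g5
    rw [hu] at g4
    push_cast at g4
    have g6 : (m : ℝ) - s + y₂.count a ≤ (min (2 * h) (y₂.count a + u.count a) : ℕ) := by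
      rw [Nat.cast_min]
      push_cast
      apply le_min
      · linarith [(abs_lt.1 g3).1, abs_nonneg ((lcs (x.drop (d + h)) v : ℝ) - ecs (d - h) v.length)]
      · linarith [(abs_lt.1 g4).1]
    refine lt_of_lt_of_le ?_ g1
    have : (lcs (x.take (d - h)) y₁ : ℝ) + (y₂.count a + lcs (x.drop (d + h)) (u ++ v)) <
        lcs (x.take (d - h)) y₁ + ((min (2 * h) (y₂.count a + u.count a) : ℕ) +
          lcs (x.drop (d + h)) v) := by
      linarith [(abs_lt.1 g2).2, (abs_lt.1 g3).1]
    exact_mod_cast this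

/-- In a typical situation the block costs at least `(3 γ* / 2 - 1) · 2 h` compared with random
letters: to be matched it needs twice its own length. -/
theorem Typical.lcs_sub_ge {d h : ℕ} {s r : ℝ} {x y : List (Fin 2)}
    (H : Typical d h s x y) (hy : y.length = 2 * d) (hh : h ≤ d) (hγ : gammaStar 2 ≤ 1)
    (hr : limLCS (2 * d) (2 * d) ≤ ecs (2 * d) (2 * d) + r) (a : Fin 2) :
    (3 * gammaStar 2 / 2 - 1) * (2 * h) - r - 4 * s ≤
      (lcs x y : ℝ) - lcs (fillBlock d h (2 * h) a x) y := by
  have g0 := (abs_lt.1 H.whole).1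
  obtain ⟨y₁, y₂, y₃, rfl, e⟩ := exists_fillBlock_eq d h (2 * h) a x y
  simp only [List.length_append] at hy
  have g1 := (abs_lt.1 (H.left y₁.length (by omega))).2
  have g2 := (abs_lt.1 (H.right (y₁.length + y₂.length) (by omega))).2
  have g3 := (abs_lt.1 (H.count y₁.length (by omega) y₂.length (by omega) (by omega) a)).2
  rw [List.drop_left, List.take_left] at g3
  rw [List.take_left] at g1
  rw [show 2 * d - (y₁.length + y₂.length) = y₃.length by omega, ← List.append_assoc,
    ← List.length_append, List.drop_left] at g2
  have g4 := ecs_le (d - h) y₁.length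
  have g5 := ecs_le (d - h) y₃.length
  have hdh : ((d - h : ℕ) : ℝ) = d - h := Nat.cast_sub hh
  rw [hdh] at g4 g5
  have hlen : (y₁.length : ℝ) + (y₂.length + y₃.length) = 2 * d := by exact_mod_cast hy
  have g6 : limLCS (2 * d) (2 * d) = 2 * d * gammaStar 2 := by
    have := limLCS_mul (2 * d) 1 1
    rw [mul_one] at this
    rw [this, gammaStar_two]
    push_cast
    ring
  have hγ0 := gammaStar_nonneg
  have hs : 0 < s := (abs_nonneg _).trans_lt H.whole
  have eR : (lcs (fillBlock d h (2 * h) a x) (y₁ ++ (y₂ ++ y₃)) : ℝ) =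
      lcs (x.take (d - h)) y₁ + ((min (2 * h) (y₂.count a) : ℕ) + lcs (x.drop (d + h)) y₃) := by
    exact_mod_cast e
  have g7 : ((min (2 * h) (y₂.count a) : ℕ) : ℝ) ≤
      (1 - gammaStar 2) * (2 * h) + gammaStar 2 * y₂.length / 2 + s := by
    rw [Nat.cast_min]
    push_cast
    rcases le_total ((y₂.length : ℝ) / 2) (2 * h) with hle | hle
    · refine (min_le_right _ _).trans ?_
      nlinarith
    · refine (min_le_left _ _).trans ?_
      nlinarith
  rw [eR]
  have g8 : gammaStar 2 * (d - h + y₁.length) / 2 + gammaStar 2 * (d - h + y₃.length) / 2 =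
      gammaStar 2 * (2 * d) - gammaStar 2 * h - gammaStar 2 * y₂.length / 2 := by
    have : (y₃.length : ℝ) = 2 * d - y₁.length - y₂.length := by linarith
    rw [this]
    ring
  linarith

/-! ### Asymptotics -/

theorem eventually_rpow_le {a b η : ℝ} (hab : a < b) (hη : 0 < η) :
    ∀ᶠ d : ℕ in atTop, (d : ℝ) ^ a ≤ η * (d : ℝ) ^ b := by
  have h : Tendsto (fun d : ℕ => (d : ℝ) ^ (-(b - a))) atTop (𝓝 0) :=
    (tendsto_rpow_neg_atTop (sub_pos.2 hab)).comp tendsto_natCast_atTop_atTop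
  filter_upwards [h.eventually (ge_mem_nhds hη), eventually_gt_atTop 0] with d hd hd0
  have hd' : (0 : ℝ) < d := by exact_mod_cast hd0
  calc (d : ℝ) ^ a = (d : ℝ) ^ (-(b - a)) * (d : ℝ) ^ b := by
        rw [← Real.rpow_add hd']; congr 1; ring
    _ ≤ _ := by gcongr

theorem eventually_const_le {b η : ℝ} (hb : 0 < b) (hη : 0 < η) (c : ℝ) :
    ∀ᶠ d : ℕ in atTop, c ≤ η * (d : ℝ) ^ b := by
  have hc : 0 < |c| + 1 := by positivity
  filter_upwards [eventually_rpow_le hb (show 0 < η / (|c| + 1) by positivity)] with d hd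
  rw [Real.rpow_zero, div_mul_eq_mul_div, le_div_iff₀ hc] at hd
  linarith [le_abs_self c]

/-- The half length of the block. -/
def halfBlock (β : ℝ) (d : ℕ) : ℕ := nearestPos ((d : ℝ) ^ β / 2)

theorem two_mul_halfBlock_le (β : ℝ) (d : ℕ) : 2 * (halfBlock β d : ℝ) ≤ (d : ℝ) ^ β + 2 := by
  have := nearestPos_le_add (x := (d : ℝ) ^ β / 2) (by positivity)
  unfold halfBlock
  linarith

theorem le_two_mul_halfBlock (β : ℝ) (d : ℕ) : (d : ℝ) ^ β - 1 ≤ 2 * (halfBlock β d : ℝ) := by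
  have := le_nearestPos_add ((d : ℝ) ^ β / 2)
  unfold halfBlock
  linarith

theorem one_le_halfBlock (β : ℝ) (d : ℕ) : 1 ≤ halfBlock β d := nearestPos_pos _

theorem halfBlock_le {β : ℝ} (hβ : β ≤ 1) {d : ℕ} (hd : 1 ≤ d) : halfBlock β d ≤ d := by
  refine nearestPos_le_of_le hd ?_
  have hd' : (1 : ℝ) ≤ d := by exact_mod_cast hd
  have : (d : ℝ) ^ β ≤ (d : ℝ) ^ (1 : ℝ) := Real.rpow_le_rpow_of_exponent_le hd' hβ
  rw [Real.rpow_one] at this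
  linarith

theorem eventually_wordProb_not_typical_le {α β κ : ℝ} (hα : 1 / 2 < α) (hβ : β ≤ 1)
    (hκ : 0 < κ) :
    ∀ᶠ d : ℕ in atTop, wordProb (2 * d) (2 * d)
      (fun x y => ¬ Typical d (halfBlock β d) (κ * (d : ℝ) ^ α) x y) ≤
        Real.exp (-(κ ^ 2 / 4) * (d : ℝ) ^ (2 * α - 1)) := by
  set η := (2 * α - 1) / 2 with hη
  have hη0 : 0 < η := by rw [hη]; linarith
  have hκ4 : 0 < κ ^ 2 / 4 := by positivity
  filter_upwards [eventually_gt_atTop 0,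
    eventually_const_le (b := 2 * α - 1) (by linarith) (half_pos hκ4) (Real.log 50),
    eventually_rpow_le (a := η) (b := 2 * α - 1) (η := κ ^ 2 / 4 / 2 / 2 * η)
      (by rw [hη]; linarith) (by positivity)] with d hd h1 h2
  have hd' : (0 : ℝ) < d := by exact_mod_cast hd
  refine (wordProb_not_typical_le hd (halfBlock_le hβ hd) (by positivity)).trans ?_
  have hlog : 2 * Real.log d ≤ κ ^ 2 / 4 / 2 * (d : ℝ) ^ (2 * α - 1) := by
    have h3 := Real.log_le_rpow_div hd'.le hη0
    have h4 : (d : ℝ) ^ η / η ≤ κ ^ 2 / 4 / 2 / 2 * (d : ℝ) ^ (2 * α - 1) := by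
      rw [div_le_iff₀ hη0]
      linarith
    linarith
  have e1 : 2 * (κ * (d : ℝ) ^ α) ^ 2 / (4 * d) = κ ^ 2 / 2 * (d : ℝ) ^ (2 * α - 1) := by
    have : ((d : ℝ) ^ α) ^ 2 = (d : ℝ) ^ (2 * α - 1) * d := by
      rw [← Real.rpow_natCast, ← Real.rpow_mul hd'.le]
      nth_rewrite 3 [← Real.rpow_one (d : ℝ)]
      rw [← Real.rpow_add hd']
      congr 1
      push_cast
      ring
    rw [mul_pow, this]
    field_simp
    ring
  have e2 : 50 * (d : ℝ) ^ 2 = Real.exp (Real.log 50 + 2 * Real.log d) := by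
    rw [Real.exp_add, Real.exp_log (by norm_num), two_mul, Real.exp_add, Real.exp_log hd']
    ring
  rw [e1, e2, ← Real.exp_add]
  apply Real.exp_le_exp.2
  linarith

/-- In long typical strings, shortening the block by `⌊d ^ α⌋` letters decreases the LCS. -/
theorem eventually_lcs_fillBlock_lt {α β : ℝ} (hα : 1 / 2 < α) (hαβ : α < β) (hβ : β < 1)
    (hγ : gammaStar 2 < 1) (hdiff : DifferentiableAt ℝ (gammaFun 2) (pMax 2)) :
    ∀ᶠ d : ℕ in atTop, ⌊(d : ℝ) ^ α⌋₊ ≤ 2 * halfBlock β d ∧ ∀ x y : List (Fin 2),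
      y.length = 2 * d →
      Typical d (halfBlock β d) ((1 - gammaStar 2) / 16 * (d : ℝ) ^ α) x y → ∀ a,
      lcs (fillBlock d (halfBlock β d) (2 * halfBlock β d - ⌊(d : ℝ) ^ α⌋₊) a x) y <
        lcs (fillBlock d (halfBlock β d) (2 * halfBlock β d) a x) y := by
  have hγ0 := gammaStar_nonneg
  have hε : 0 < (1 - gammaStar 2) / 16 := by linarith
  obtain ⟨δ, hδ0, hδ1, hδ⟩ := exists_limLCS_ge hdiff hε
  obtain ⟨C, hC, hrate⟩ := exists_rate ((α + 1 / 2) / 2) (by linarith)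
  obtain ⟨m₀, hm₀⟩ := eventually_atTop.1 hδ
  filter_upwards [eventually_gt_atTop 0,
    eventually_const_le (b := α) (η := 1 / 2) (by linarith) (by norm_num) 1,
    eventually_rpow_le (η := 1 / 2) hαβ (by norm_num),
    eventually_const_le (b := β) (η := 1 / 2) (by linarith) (by norm_num) 1,
    eventually_rpow_le (η := δ / 12) hβ (by positivity),
    eventually_rpow_le (η := δ / 24) (hαβ.trans hβ) (by positivity),
    eventually_const_le (b := 1) (η := δ / 12) (by norm_num) (by positivity) 2,
    eventually_const_le (b := 1) (η := 1 / 2) (by norm_num) (by norm_num) (m₀ : ℝ),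
    eventually_rpow_le (a := (α + 1 / 2) / 2) (b := α)
      (η := (1 - gammaStar 2) / 8 / (C * 3 ^ ((α + 1 / 2) / 2)))
      (by linarith) (by
        have : 0 < 1 - gammaStar 2 := by linarith
        positivity)] with d hd h1 h2 h3 h4 h5 h6 h7 h8
  rw [Real.rpow_one] at h4 h5 h6 h7
  have hd' : (0 : ℝ) < d := by exact_mod_cast hd
  set h := halfBlock β d with hh
  set m := ⌊(d : ℝ) ^ α⌋₊ with hm
  have hhle : 2 * (h : ℝ) ≤ (d : ℝ) ^ β + 2 := two_mul_halfBlock_le β d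
  have hhge : (d : ℝ) ^ β - 1 ≤ 2 * (h : ℝ) := le_two_mul_halfBlock β d
  have hmle : (m : ℝ) ≤ (d : ℝ) ^ α := Nat.floor_le (by positivity)
  have hmge : (d : ℝ) ^ α ≤ 2 * m := by
    have := Nat.lt_floor_add_one ((d : ℝ) ^ α)
    linarith
  have hm1 : 1 ≤ m := Nat.le_floor (by push_cast; linarith)
  have hmh : m ≤ 2 * h := by
    have : (m : ℝ) ≤ 2 * h := by linarith
    exact_mod_cast this
  refine ⟨hmh, fun x y hy H a => ?_⟩
  have hsum : 2 * (h : ℝ) + 2 * m ≤ δ / 4 * d := by linarith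
  have hsum1 : 2 * (h : ℝ) + 2 * m ≤ d := by nlinarith
  have hsum' : 2 * h + 2 * m ≤ d := by exact_mod_cast hsum1
  have hdh : ((d - h : ℕ) : ℝ) = d - h := Nat.cast_sub (by omega)
  have hn1 : m₀ ≤ d - h := by
    have : (m₀ : ℝ) ≤ ((d - h : ℕ) : ℝ) := by
      rw [hdh]
      have : (0 : ℝ) ≤ m := m.cast_nonneg
      linarith
    exact_mod_cast this
  obtain ⟨n₀, hn₀, hn₀'⟩ := hm₀ (d - h) hn1
  set r := C * (3 * (d : ℝ)) ^ ((α + 1 / 2) / 2) with hr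
  have hr8 : r ≤ (1 - gammaStar 2) / 8 * (d : ℝ) ^ α := by
    have hc : 0 < C * (3 : ℝ) ^ ((α + 1 / 2) / 2) := by positivity
    rw [div_mul_eq_mul_div, le_div_iff₀ hc] at h8
    rw [hr, Real.mul_rpow (by norm_num) hd'.le]
    linarith
  have hpow : 0 < (d : ℝ) ^ α := by positivity
  refine H.lcs_fillBlock_lt
    (K := (2 * m : ℕ) * (gammaStar 2 / 2 + 2 * ((1 - gammaStar 2) / 16)) + r)
    hy hm1 hmh hsum' ?_ ?_ ?_ a
  · have : (1 - gammaStar 2) / 16 * (d : ℝ) ^ α ≤ 1 / 2 * (d : ℝ) ^ α :=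
      mul_le_mul_of_nonneg_right (by linarith) hpow.le
    linarith
  · intro i hi hi2
    have h9 : 2 * m ≤ i := by omega
    have hiR : (d : ℝ) - 2 * h ≤ i := by
      have : d ≤ i + 2 * h := by omega
      have : (d : ℝ) ≤ i + 2 * h := by exact_mod_cast this
      linarith
    have hn1pos : 0 < d - h := by omega
    have h10 := limLCS_sub_le hε.le hδ0 hn1pos hn₀ hn₀' h9 (by
      push_cast
      rw [hdh]
      have : (0 : ℝ) ≤ h := h.cast_nonneg
      nlinarith)
    have h11 := ecs_le_limLCS (d - h) i
    have h12 := hrate (d - h) (i - 2 * m)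
    have h13 : C * (((d - h : ℕ) : ℝ) + (i - 2 * m : ℕ)) ^ ((α + 1 / 2) / 2) ≤ r := by
      rw [hr]
      gcongr
      exact_mod_cast (by omega : (d - h) + (i - 2 * m) ≤ 3 * d)
    linarith
  · push_cast
    nlinarith

/-- In long typical strings, replacing the block by random letters increases the LCS by a
multiple of the length of the block. -/
theorem eventually_le_lcs_sub {α β c : ℝ} (hα : 1 / 2 < α) (hαβ : α < β) (hβ : β < 1)
    (hγ : gammaStar 2 < 1) (hc0 : 0 < c) (hc : c < 3 * gammaStar 2 / 2 - 1) :
    ∀ᶠ d : ℕ in atTop, ∀ x y : List (Fin 2), y.length = 2 * d →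
      Typical d (halfBlock β d) (1 * (d : ℝ) ^ α) x y → ∀ a,
      c * (d : ℝ) ^ β ≤
        (lcs x y : ℝ) - lcs (fillBlock d (halfBlock β d) (2 * halfBlock β d) a x) y := by
  obtain ⟨C, hC, hrate⟩ := exists_rate α hα
  set e := 3 * gammaStar 2 / 2 - 1 with he
  have hec : 0 < e - c := by linarith
  filter_upwards [eventually_gt_atTop 0,
    eventually_rpow_le (η := (e - c) / 2 / (C * 4 ^ α + 4)) hαβ (by positivity),
    eventually_const_le (b := β) (η := (e - c) / 2) (by linarith) (by positivity) e]
    with d hd h1 h2 x y hy H a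
  have hd' : (0 : ℝ) < d := by exact_mod_cast hd
  have h3 := H.lcs_sub_ge hy (halfBlock_le hβ.le hd) hγ.le (hrate (2 * d) (2 * d)) a
  have h4 : C * (((2 * d : ℕ) : ℝ) + (2 * d : ℕ)) ^ α = C * 4 ^ α * (d : ℝ) ^ α := by
    rw [mul_assoc, ← Real.mul_rpow (by norm_num) hd'.le]
    congr 2
    push_cast
    ring
  rw [h4, ← he] at h3
  have hc' : 0 < C * (4 : ℝ) ^ α + 4 := by positivity
  rw [div_mul_eq_mul_div, le_div_iff₀ hc'] at h1
  have h5 := le_two_mul_halfBlock β d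
  have he0 : 0 ≤ e := by linarith
  have h6 := mul_le_mul_of_nonneg_left h5 he0
  linarith

/-! ### Alignments and common subsequences -/

theorem ofFn_sublist {A : Type*} {n : ℕ} {f : Fin n → A} {L : List A} (φ : Fin n → ℕ)
    (hφ : StrictMono φ) (hlt : ∀ k, φ k < L.length) (h : ∀ k, L[φ k]'(hlt k) = f k) :
    (List.ofFn f).Sublist L := by
  have hlen : (List.ofFn f).length = n := List.length_ofFn
  refine List.sublist_iff_exists_fin_orderEmbedding_get_eq.2
    ⟨OrderEmbedding.ofStrictMono (fun k => ⟨φ (Fin.cast hlen k), hlt _⟩) fun a b hab => ?_, ?_⟩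
  · exact hφ (by simpa using hab)
  · intro k
    have := h (Fin.cast hlen k)
    simp only [List.get_eq_getElem, List.getElem_ofFn]
    exact this.symm

/-- A longest common subsequence is the string of letters of some alignment. -/
theorem exists_alignment {A : Type*} {n m : ℕ} (x : Fin n → A) (y : Fin m → A) :
    ∃ π : Finset (Fin n × Fin m), IsAlignment x y π ∧ π.card = lcsFn x y := by
  classical
  obtain ⟨z, hx, hy, hz⟩ := exists_length_eq_lcs (List.ofFn x) (List.ofFn y)
  obtain ⟨f, hf⟩ := List.sublist_iff_exists_fin_orderEmbedding_get_eq.1 hx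
  obtain ⟨g, hg⟩ := List.sublist_iff_exists_fin_orderEmbedding_get_eq.1 hy
  let F : Fin z.length → Fin n × Fin m := fun k =>
    (Fin.cast List.length_ofFn (f k), Fin.cast List.length_ofFn (g k))
  have hF₁ : StrictMono fun k => (F k).1 := fun _ _ hkl => f.strictMono hkl
  have hF₂ : StrictMono fun k => (F k).2 := fun _ _ hkl => g.strictMono hkl
  refine ⟨Finset.univ.image F, ⟨?_, ?_⟩, ?_⟩
  · intro p hp
    obtain ⟨k, -, rfl⟩ := Finset.mem_image.1 hp
    have := (hf k).symm.trans (hg k)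
    simp only [List.get_eq_getElem, List.getElem_ofFn] at this
    exact this
  · intro p hp q hq
    obtain ⟨k, -, rfl⟩ := Finset.mem_image.1 hp
    obtain ⟨l, -, rfl⟩ := Finset.mem_image.1 hq
    exact ⟨hF₁.lt_iff_lt.trans hF₂.lt_iff_lt.symm,
      hF₁.injective.eq_iff.trans hF₂.injective.eq_iff.symm⟩
  · rw [Finset.card_image_of_injective, Finset.card_univ, Fintype.card_fin, hz]
    · rfl
    · exact fun k l hkl => hF₁.injective (congrArg Prod.fst hkl)

theorem card_block_le (d h : ℕ) : (block d (2 * h)).card ≤ 2 * h := by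
  have h1 : (block d (2 * h)).card ≤ (Finset.Ico (d - h) (d + h)).card := by
    refine Finset.card_le_card_of_injOn (fun i => (i : ℕ)) ?_ (Fin.val_injective.injOn)
    intro i hi
    simp [block] at hi
    simpa using hi
  rw [Nat.card_Ico] at h1
  omega

/-- An alignment that leaves `m` letters of a constant block unmatched survives the removal of
`m` letters of the block. -/
theorem card_le_lcs_cutBlock {A : Type*} {d h m : ℕ} (hh : h ≤ d) {x y : Fin (2 * d) → A}
    (hconst : ∀ i ∈ block d (2 * h), ∀ j ∈ block d (2 * h), x i = x j)
    {π : Finset (Fin (2 * d) × Fin (2 * d))} (hπ : IsAlignment x y π)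
    (hm : m ≤ gapCount (block d (2 * h)) π) :
    π.card ≤ lcs (cutBlock (2 * h) m x) (List.ofFn y) := by
  classical
  set S := π.image Prod.fst with hS
  have hcard : S.card = π.card := by
    refine Finset.card_image_of_injOn fun p hp q hq hpq => ?_
    exact Prod.ext hpq (((hπ.2 p hp q hq).2).1 hpq)
  have hr : (block d (2 * h) ∩ S).card + m ≤ 2 * h := by
    have h1 := card_block_le d h
    have h2 := Finset.card_inter_add_card_sdiff (block d (2 * h)) S
    unfold gapCount at hm
    rw [← hS] at hm
    omega
  have hpart : ∀ i ∈ S, ∃ j, (i, j) ∈ π := by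
    intro i hi
    obtain ⟨p, hp, rfl⟩ := Finset.mem_image.1 hi
    exact ⟨p.2, hp⟩
  choose! g hg using hpart
  have hgmono : ∀ i ∈ S, ∀ j ∈ S, i < j → g i < g j := fun i hi j hj hij =>
    ((hπ.2 _ (hg i hi) _ (hg j hj)).1).1 hij
  have mem_block : ∀ i : Fin (2 * d), i ∈ block d (2 * h) ↔ d - h ≤ (i : ℕ) ∧ (i : ℕ) < d + h := by
    intro i
    simp [block]
  let rank : Fin (2 * d) → ℕ := fun i => ((block d (2 * h) ∩ S).filter (· < i)).card
  have hrank : ∀ i ∈ S, i ∈ block d (2 * h) → rank i < (block d (2 * h) ∩ S).card := by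
    intro i hi hib
    refine Finset.card_lt_card (Finset.filter_ssubset.2 ⟨i, Finset.mem_inter.2 ⟨hib, hi⟩, ?_⟩)
    exact lt_irrefl i
  have hrank_lt : ∀ i ∈ S, i ∈ block d (2 * h) → ∀ j, i < j → rank i < rank j := by
    intro i hi hib j hij
    refine Finset.card_lt_card (Finset.ssubset_iff_of_subset ?_ |>.2 ⟨i, ?_, ?_⟩)
    · exact Finset.monotone_filter_right _ fun k _ hk => lt_trans hk hij
    · exact Finset.mem_filter.2 ⟨Finset.mem_inter.2 ⟨hib, hi⟩, hij⟩
    · simp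
  -- the new positions of the matched letters
  let φ : Fin (2 * d) → ℕ := fun i =>
    if (i : ℕ) < d - h then i else if (i : ℕ) < d + h then d - h + rank i else i - m
  have hφmono : ∀ i ∈ S, ∀ j ∈ S, i < j → φ i < φ j := by
    intro i hi j hj hij
    have hij' : (i : ℕ) < j := hij
    have r1 := hrank i hi
    have r2 := hrank_lt i hi
    rw [mem_block] at r1 r2
    simp only [φ]
    split_ifs with c1 c2 c3 c4 c5 c6 c7
    all_goals first
      | omega
      | (have := r1 ⟨by omega, by omega⟩; have := r2 ⟨by omega, by omega⟩ j hij; omega)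
  have hlen : (cutBlock (2 * h) m x).length = d - h + (2 * d - (d - h + m)) := by
    simp only [cutBlock, List.length_append, List.length_take, List.length_drop, List.length_ofFn]
    omega
  have hφlt : ∀ i ∈ S, φ i < (cutBlock (2 * h) m x).length := by
    intro i hi
    have r1 := hrank i hi
    rw [mem_block] at r1
    rw [hlen]
    have := i.2
    simp only [φ]
    split_ifs with c1 c2
    · omega
    · have := r1 ⟨by omega, by omega⟩
      omega
    · omega
  have hget : ∀ (p : ℕ) (hp : p < (cutBlock (2 * h) m x).length),
      (cutBlock (2 * h) m x)[p] = if hp' : p < d - h then x ⟨p, by omega⟩ else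
        x ⟨p + m, by omega⟩ := by
    intro p hp
    have hmin : min (d - h) (2 * d) = d - h := by omega
    simp only [cutBlock, List.getElem_append, List.length_take, List.length_ofFn,
      Nat.mul_div_cancel_left h (by norm_num : 0 < 2), hmin, List.getElem_take, List.getElem_drop,
      List.getElem_ofFn]
    split_ifs with c
    · rfl
    · congr 2
      omega
  have hφget : ∀ i (hi : i ∈ S), (cutBlock (2 * h) m x)[φ i]'(hφlt i hi) = x i := by
    intro i hi
    have r1 := hrank i hi
    rw [hget]
    by_cases c1 : (i : ℕ) < d - h
    · have e : φ i = i := by simp only [φ, if_pos c1]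
      rw [dif_pos (by omega)]
      congr 1
      exact Fin.ext e
    · by_cases c2 : (i : ℕ) < d + h
      · have hib : i ∈ block d (2 * h) := (mem_block i).2 ⟨by omega, c2⟩
        have e : φ i = d - h + rank i := by simp only [φ, if_neg c1, if_pos c2]
        have := r1 hib
        rw [dif_neg (by omega)]
        refine hconst _ ((mem_block _).2 ⟨?_, ?_⟩) _ hib
        · simp only; omega
        · simp only; omega
      · have e : φ i = i - m := by simp only [φ, if_neg c1, if_neg c2]
        rw [dif_neg (by omega)]
        congr 1
        apply Fin.ext
        simp only
        omega
  set e := S.orderEmbOfFin hcard with he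
  have heS : ∀ k, e k ∈ S := fun k => Finset.orderEmbOfFin_mem S hcard k
  have hz1 : (List.ofFn fun k => x (e k)).Sublist (cutBlock (2 * h) m x) :=
    ofFn_sublist (fun k => φ (e k))
      (fun k l hkl => hφmono _ (heS k) _ (heS l) (e.strictMono hkl))
      (fun k => hφlt _ (heS k)) (fun k => hφget _ (heS k))
  have hz2 : (List.ofFn fun k => x (e k)).Sublist (List.ofFn y) :=
    ofFn_sublist (fun k => (g (e k) : ℕ))
      (fun k l hkl => hgmono _ (heS k) _ (heS l) (e.strictMono hkl))
      (fun k => by simp) (fun k => by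
        rw [List.getElem_ofFn]
        exact (hπ.1 _ (hg _ (heS k))).symm)
  simpa using length_le_lcs hz1 hz2

/-- If shortening the block decreases the LCS, then no optimal alignment leaves more letters of
the block unmatched than were removed. -/
theorem gapCount_le_of_lcs_cutBlock_lt {A : Type*} {d h : ℕ} {s : ℝ} (hh : h ≤ d)
    {x y : Fin (2 * d) → A}
    (hconst : ∀ i ∈ block d (2 * h), ∀ j ∈ block d (2 * h), x i = x j)
    (hlt : lcs (cutBlock (2 * h) ⌊s⌋₊ x) (List.ofFn y) < lcsFn x y)
    {π : Finset (Fin (2 * d) × Fin (2 * d))} (hπ : IsOptimalAlignment x y π) :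
    (gapCount (block d (2 * h)) π : ℝ) ≤ s := by
  by_contra hcon
  push Not at hcon
  obtain ⟨π', hπ', hcard⟩ := exists_alignment x y
  have h1 := hπ.2 π' hπ'
  have h2 := card_le_lcs_cutBlock hh hconst hπ.1 (Nat.floor_le_of_le hcon.le)
  omega

/-! ### The model with a long block -/

theorem mem_block {d h : ℕ} {i : Fin (2 * d)} :
    i ∈ block d (2 * h) ↔ d - h ≤ (i : ℕ) ∧ (i : ℕ) < d + h := by
  simp [block]

theorem ofFn_eq_fillBlock {d h : ℕ} (hh : h ≤ d) {x xs : Fin (2 * d) → Fin 2} {a : Fin 2}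
    (hb : ∀ i ∈ block d (2 * h), x i = a) (ho : ∀ i, i ∉ block d (2 * h) → xs i = x i) :
    List.ofFn x = fillBlock d h (2 * h) a (List.ofFn xs) := by
  have hmin : min (d - h) (2 * d) = d - h := by omega
  refine List.ext_getElem ?_ fun i h1 h2 => ?_
  · simp only [fillBlock, List.length_append, List.length_take, List.length_drop,
      List.length_replicate, List.length_ofFn]
    omega
  · rw [List.length_ofFn] at h1
    simp only [fillBlock, List.getElem_append, List.length_take, List.length_ofFn, hmin,
      List.length_replicate, List.getElem_take, List.getElem_drop, List.getElem_ofFn,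
      List.getElem_replicate]
    split_ifs with c1 c2
    · exact (ho _ fun hi => by have := (mem_block.1 hi).1; simp only at this; omega).symm
    · exact hb _ (mem_block.2 ⟨by simp only; omega, by simp only; omega⟩)
    · rw [← ho _ fun hi => by have := (mem_block.1 hi).2; simp only at this; omega]
      congr 2
      omega

theorem cutBlock_eq_fillBlock {d h m : ℕ} (hh : h ≤ d) (hm : m ≤ 2 * h)
    {x xs : Fin (2 * d) → Fin 2} {a : Fin 2}
    (hb : ∀ i ∈ block d (2 * h), x i = a) (ho : ∀ i, i ∉ block d (2 * h) → xs i = x i) :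
    cutBlock (2 * h) m x = fillBlock d h (2 * h - m) a (List.ofFn xs) := by
  have hlen : ((List.ofFn xs).take (d - h)).length = d - h := by
    rw [List.length_take, List.length_ofFn]; omega
  unfold cutBlock
  rw [ofFn_eq_fillBlock hh hb ho, Nat.mul_div_cancel_left h (by norm_num : 0 < 2)]
  unfold fillBlock
  congr 1
  · exact List.take_left' hlen
  · rw [← List.drop_drop, List.drop_left' hlen,
      List.drop_append_of_le_length (by simpa using hm), List.drop_replicate]

section Model

variable {Ω : Type*} [MeasurableSpace Ω] {P : Measure Ω} {d ℓ : ℕ}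
  {X Xs Y : Fin (2 * d) → Ω → Fin 2}

theorem LongBlockModel.real_eq (M : LongBlockModel P 2 d ℓ X Xs Y) (x y : Fin (2 * d) → Fin 2) :
    P.real {ω | (∀ i, Xs i ω = x i) ∧ ∀ i, Y i ω = y i} = (1 / 2) ^ (4 * d) := by
  have hset : {ω | (∀ i, Xs i ω = x i) ∧ ∀ i, Y i ω = y i} =
      ⋂ s ∈ (Finset.univ : Finset (Fin (2 * d) ⊕ Fin (2 * d))),
        Sum.elim Xs Y s ⁻¹' {Sum.elim x y s} := by
    ext ω
    simp
  have h := M.indep.measure_inter_preimage_eq_mul Finset.univ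
    (sets := fun s => {Sum.elim x y s}) (fun s _ => measurableSet_singleton _)
  rw [hset, measureReal_def, h, ENNReal.toReal_prod, Fintype.prod_sum_type]
  have h1 : ∀ i, (P (Sum.elim Xs Y (Sum.inl i) ⁻¹' {Sum.elim x y (Sum.inl i)})).toReal = 1 / 2 :=
    fun i => (M.unif_Xs i (x i)).trans (by norm_num)
  have h2 : ∀ i, (P (Sum.elim Xs Y (Sum.inr i) ⁻¹' {Sum.elim x y (Sum.inr i)})).toReal = 1 / 2 :=
    fun i => (M.unif_Y i (y i)).trans (by norm_num)
  simp only [h1, h2, Finset.prod_const, Finset.card_univ, Fintype.card_fin, ← pow_add]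
  congr 1
  ring

variable [IsProbabilityMeasure P]

theorem LongBlockModel.real_le_wordProb (M : LongBlockModel P 2 d ℓ X Xs Y)
    (Q : List (Fin 2) → List (Fin 2) → Prop) :
    P.real {ω | Q (List.ofFn fun i => Xs i ω) (List.ofFn fun i => Y i ω)} ≤
      wordProb (2 * d) (2 * d) Q := by
  classical
  set S := (Finset.univ : Finset ((Fin (2 * d) → Fin 2) × (Fin (2 * d) → Fin 2))).filter
    (fun p => Q (List.ofFn p.1) (List.ofFn p.2)) with hS
  have hsub : {ω | Q (List.ofFn fun i => Xs i ω) (List.ofFn fun i => Y i ω)} ⊆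
      ⋃ p ∈ S, {ω | (∀ i, Xs i ω = p.1 i) ∧ ∀ i, Y i ω = p.2 i} := by
    intro ω hω
    simp only [Set.mem_iUnion]
    exact ⟨(fun i => Xs i ω, fun i => Y i ω), by simpa [hS] using hω, fun _ => rfl, fun _ => rfl⟩
  refine (measureReal_mono hsub (measure_ne_top P _)).trans
    ((measureReal_biUnion_finset_le _ _).trans ?_)
  simp only [M.real_eq]
  rw [hS, Finset.sum_filter, Fintype.sum_prod_type]
  unfold wordProb
  simp only [avg_eq_sum]
  rw [← Finset.sum_div, div_div, Finset.sum_div]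
  refine Finset.sum_le_sum fun x _ => ?_
  rw [Finset.sum_div]
  refine Finset.sum_le_sum fun y _ => ?_
  rw [← pow_add, show 2 * d + 2 * d = 4 * d by ring, one_div, inv_pow, ite_div, zero_div, one_div]

theorem one_sub_le_real {E : Set Ω} {q : ℝ} (h : P.real Eᶜ ≤ q) : 1 - q ≤ P.real E := by
  have h1 : P.real (E ∪ Eᶜ) ≤ P.real E + P.real Eᶜ := measureReal_union_le _ _
  rw [Set.union_compl_self, probReal_univ] at h1
  linarith

theorem real_mono_ae {E F : Set Ω} (h : ∀ᵐ ω ∂P, ω ∈ E → ω ∈ F) : P.real E ≤ P.real F :=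
  ENNReal.toReal_mono (measure_ne_top P F) (measure_mono_ae h)

/-- The string of zeros with the block filled with the letter `a`. -/
def pattern (d ℓ : ℕ) (a : Fin 2) (i : Fin (2 * d)) : Fin 2 := if i ∈ block d ℓ then a else 0

/-- An event that is certain for some values of the fresh letters and of `Y`, for each of the two
letters of the block, has a probability bounded below in terms of `d` only. -/
theorem LongBlockModel.le_real (M : LongBlockModel P 2 d ℓ X Xs Y) (hne : (block d ℓ).Nonempty)
    {E : Set Ω}
    (hE : ∀ a, ∃ u y : Fin (2 * d) → Fin 2, ∀ ω, (∀ i, X i ω = pattern d ℓ a i) →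
      (∀ i ∈ block d ℓ, Xs i ω = u i) → (∀ i, i ∉ block d ℓ → Xs i ω = X i ω) →
      (∀ i, Y i ω = y i) → ω ∈ E) :
    (1 / 2) ^ (8 * d) / 2 ≤ P.real E := by
  obtain ⟨i₀, hi₀⟩ := hne
  -- one of the two patterns has a large probability
  obtain ⟨a, ha⟩ : ∃ a, (1 / 2 : ℝ) ^ (4 * d) / 2 ≤
      P.real {ω | ∀ i, X i ω = pattern d ℓ a i} := by
    by_contra hcon
    push Not at hcon
    have h1 := M.real_eq (fun _ => 0) (fun _ => 0)
    have h2 : P.real {ω | (∀ i, Xs i ω = 0) ∧ ∀ i, Y i ω = 0} ≤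
        P.real ({ω | ∀ i, X i ω = pattern d ℓ 0 i} ∪ {ω | ∀ i, X i ω = pattern d ℓ 1 i}) := by
      refine real_mono_ae ?_
      filter_upwards [M.const, M.agree] with ω hc hag hω
      have hpat : ∀ i, X i ω = pattern d ℓ (X i₀ ω) i := by
        intro i
        unfold pattern
        split_ifs with hi
        · exact hc i hi i₀ hi₀
        · rw [← hag i hi]
          exact hω.1 i
      rcases (by omega : X i₀ ω = 0 ∨ X i₀ ω = 1) with h | h
      · left; rw [h] at hpat; exact hpat
      · right; rw [h] at hpat; exact hpat
    have h3 := measureReal_union_le (μ := P) {ω | ∀ i, X i ω = pattern d ℓ 0 i}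
      {ω | ∀ i, X i ω = pattern d ℓ 1 i}
    linarith [hcon 0, hcon 1]
  obtain ⟨u, y, huy⟩ := hE a
  set A : Set (Fin (2 * d) → Fin 2) := {pattern d ℓ a} with hA
  set B : Set (({i // i ∈ block d ℓ} → Fin 2) × (Fin (2 * d) → Fin 2)) :=
    {(fun i => u i.1, y)} with hB
  have hind := M.fresh.measure_inter_preimage_eq_mul A B (measurableSet_singleton _)
    (measurableSet_singleton _)
  have hXA : (fun ω (i : Fin (2 * d)) => X i ω) ⁻¹' A = {ω | ∀ i, X i ω = pattern d ℓ a i} := by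
    ext ω
    simp [hA, funext_iff]
  have hBle : (1 / 2 : ℝ) ^ (4 * d) ≤ P.real ((fun ω => ((fun i : {i // i ∈ block d ℓ} => Xs i.1 ω),
      fun j : Fin (2 * d) => Y j ω)) ⁻¹' B) := by
    rw [← M.real_eq u y]
    refine measureReal_mono fun ω hω => ?_
    simp only [hB, Set.mem_preimage, Set.mem_singleton_iff, Prod.mk.injEq, funext_iff]
    exact ⟨fun i => hω.1 i.1, hω.2⟩
  have hind' := congrArg ENNReal.toReal hind
  rw [ENNReal.toReal_mul] at hind'
  change P.real _ = P.real _ * P.real _ at hind'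
  rw [← hXA] at ha
  have hmul := mul_le_mul ha hBle (by positivity) measureReal_nonneg
  rw [← hind'] at hmul
  calc (1 / 2 : ℝ) ^ (8 * d) / 2 = (1 / 2) ^ (4 * d) / 2 * (1 / 2) ^ (4 * d) := by
        rw [show 8 * d = 4 * d + 4 * d by ring, pow_add]; ring
    _ ≤ _ := hmul
    _ ≤ P.real E := by
        refine real_mono_ae ?_
        filter_upwards [M.agree] with ω hag hω
        obtain ⟨h1, h2⟩ := hω
        simp only [hA, hB, Set.mem_preimage, Set.mem_singleton_iff, Prod.mk.injEq,
          funext_iff] at h1 h2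
        exact huy ω h1 (fun i hi => h2.1 ⟨i, hi⟩) hag h2.2

end Model

/-- A lower bound for long strings and a lower bound that depends on the length combine into an
exponential bound for all lengths. -/
theorem exists_forall_one_sub_exp_le {c τ : ℝ} (hc : 0 < c) (hτ1 : τ ≤ 1) (d₀ : ℕ) :
    ∃ C : ℝ, 0 < C ∧ ∀ d : ℕ, 1 ≤ d → ∀ q : ℝ,
      (d₀ ≤ d → 1 - Real.exp (-c * (d : ℝ) ^ τ) ≤ q) → (1 / 2) ^ (8 * d) / 2 ≤ q →
      1 - Real.exp (-C * (d : ℝ) ^ τ) ≤ q := by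
  set p : ℝ := (1 / 2) ^ (8 * d₀) / 2 with hp
  have hp0 : 0 < p := by positivity
  have hd₀ : (0 : ℝ) < d₀ + 1 := by positivity
  refine ⟨min c (p / (d₀ + 1)), lt_min hc (by positivity), fun d hd q h1 h2 => ?_⟩
  have hd' : (1 : ℝ) ≤ d := by exact_mod_cast hd
  have hpow : 0 < (d : ℝ) ^ τ := by positivity
  rcases le_or_gt d₀ d with hle | hlt
  · refine le_trans ?_ (h1 hle)
    have h3 := mul_le_mul_of_nonneg_right (min_le_left c (p / (d₀ + 1))) hpow.le
    have h4 : Real.exp (-c * (d : ℝ) ^ τ) ≤ Real.exp (-(min c (p / (d₀ + 1))) * (d : ℝ) ^ τ) :=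
      Real.exp_le_exp.2 (by linarith)
    linarith
  · refine le_trans ?_ h2
    have h3 := mul_le_mul_of_nonneg_right (min_le_right c (p / (d₀ + 1))) hpow.le
    have h4 : (d : ℝ) ^ τ ≤ d₀ + 1 := by
      calc (d : ℝ) ^ τ ≤ (d : ℝ) ^ (1 : ℝ) := Real.rpow_le_rpow_of_exponent_le hd' hτ1
        _ = d := Real.rpow_one _
        _ ≤ d₀ + 1 := by exact_mod_cast hlt.le.trans (Nat.le_succ _)
    have h5 : p / (d₀ + 1) * (d : ℝ) ^ τ ≤ p := by
      calc _ ≤ p / (d₀ + 1) * (d₀ + 1) := by gcongr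
        _ = p := div_mul_cancel₀ _ hd₀.ne'
    have h6 := Real.one_sub_le_exp_neg (min c (p / (d₀ + 1)) * (d : ℝ) ^ τ)
    rw [← neg_mul] at h6
    have h7 : p ≤ (1 / 2) ^ (8 * d) / 2 := by
      rw [hp]
      have : (1 / 2 : ℝ) ^ (8 * d₀) ≤ (1 / 2) ^ (8 * d) :=
        pow_le_pow_of_le_one (by norm_num) (by norm_num) (by omega)
      linarith
    linarith

theorem block_nonempty {d h : ℕ} (hd : 1 ≤ d) (hh : 1 ≤ h) : (block d (2 * h)).Nonempty :=
  ⟨⟨d, by omega⟩, mem_block.2 ⟨by simp only; omega, by simp only; omega⟩⟩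

theorem blockLen_eq (β : ℝ) (d : ℕ) : blockLen β d = 2 * halfBlock β d := rfl

section Events

variable {Ω : Type*} [MeasurableSpace Ω] {P : Measure Ω} [IsProbabilityMeasure P] {d h : ℕ}
  {X Xs Y : Fin (2 * d) → Ω → Fin 2}

theorem LongBlockModel.real_eventG_le (M : LongBlockModel P 2 d (2 * h) X Xs Y) (hh : h ≤ d)
    (α : ℝ) : P.real (eventG α (2 * h) X Y) ≤ P.real (eventGaps α (2 * h) X Y) := by
  refine real_mono_ae ?_
  filter_upwards [M.const] with ω hc hω π hπ
  exact gapCount_le_of_lcs_cutBlock_lt hh hc hω hπ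

theorem LongBlockModel.le_real_eventG (M : LongBlockModel P 2 d (2 * h) X Xs Y) (hd : 1 ≤ d)
    (hh : h ≤ d) (hh1 : 1 ≤ h) {α : ℝ} (hα : 0 ≤ α) :
    (1 / 2) ^ (8 * d) / 2 ≤ P.real (eventG α (2 * h) X Y) := by
  refine M.le_real (block_nonempty hd hh1) fun a =>
    ⟨pattern d (2 * h) a, pattern d (2 * h) a, fun ω hX _ _ hY => ?_⟩
  have e : (fun i => Y i ω) = fun i => X i ω := funext fun i => by rw [hX, hY]
  have hm : 1 ≤ ⌊(d : ℝ) ^ α⌋₊ := by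
    refine Nat.le_floor ?_
    have hd' : (1 : ℝ) ≤ d := by exact_mod_cast hd
    simpa using Real.one_le_rpow hd' hα
  have h1 := lcs_le_length_left (cutBlock (2 * h) ⌊(d : ℝ) ^ α⌋₊ fun i => X i ω)
    (List.ofFn fun i => X i ω)
  simp only [cutBlock, List.length_append, List.length_take, List.length_drop,
    List.length_ofFn] at h1
  simp only [eventG, Set.mem_ofPred_eq, lcsFn, e, lcs_self, List.length_ofFn]
  unfold cutBlock
  omega

theorem LongBlockModel.le_real_eventH (M : LongBlockModel P 2 d (2 * h) X Xs Y) (hd : 1 ≤ d)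
    (hh : h ≤ d) (hh1 : 1 ≤ h) {β c : ℝ} (hc : c * (d : ℝ) ^ β ≤ 2 * h) :
    (1 / 2) ^ (8 * d) / 2 ≤ P.real (eventH β c X Xs Y) := by
  have hzero : List.ofFn (pattern d (2 * h) 0) = List.replicate (2 * d) 0 := by
    rw [← List.ofFn_const]
    congr 1
    ext i
    simp [pattern]
  have hle : lcs (List.ofFn (pattern d (2 * h) 0)) (List.ofFn (pattern d (2 * h) 1)) + 2 * h ≤
      2 * d := by
    rw [ofFn_eq_fillBlock hh (a := 1) (x := pattern d (2 * h) 1) (xs := pattern d (2 * h) 0)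
      (fun i hi => by simp [pattern, hi]) (fun i hi => by simp [pattern, hi]), hzero, lcs_replicate]
    refine le_trans (Nat.add_le_add_right (min_le_right _ _) _) ?_
    simp only [fillBlock, List.count_append, List.take_replicate, List.drop_replicate,
      List.count_replicate_self, List.count_replicate]
    norm_num
    omega
  have hle' : lcs (List.ofFn (pattern d (2 * h) 1)) (List.ofFn (pattern d (2 * h) 0)) + 2 * h ≤
      2 * d := by
    rw [lcs_comm]
    exact hle
  -- the fresh letters and `Y` agree with the pattern of the opposite letter
  have key : ∀ a b : Fin 2, lcs (List.ofFn (pattern d (2 * h) a))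
      (List.ofFn (pattern d (2 * h) b)) + 2 * h ≤ 2 * d → ∀ ω,
      (∀ i, X i ω = pattern d (2 * h) a i) →
      (∀ i ∈ block d (2 * h), Xs i ω = pattern d (2 * h) b i) →
      (∀ i, i ∉ block d (2 * h) → Xs i ω = X i ω) → (∀ i, Y i ω = pattern d (2 * h) b i) →
      ω ∈ eventH β c X Xs Y := by
    intro a b hab ω hX hXs hag hY
    have e1 : (fun i => X i ω) = pattern d (2 * h) a := funext hX
    have e2 : (fun i => Y i ω) = pattern d (2 * h) b := funext hY
    have e3 : (fun i => Xs i ω) = pattern d (2 * h) b := by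
      funext i
      by_cases hi : i ∈ block d (2 * h)
      · exact hXs i hi
      · rw [hag i hi, hX i]
        simp [pattern, hi]
    simp only [eventH, Set.mem_ofPred_eq, lcsFn, e1, e2, e3, lcs_self, List.length_ofFn]
    have : (lcs (List.ofFn (pattern d (2 * h) a)) (List.ofFn (pattern d (2 * h) b)) : ℝ) + 2 * h ≤
        (2 * d : ℕ) := by exact_mod_cast hab
    linarith
  refine M.le_real (block_nonempty hd hh1) fun a => ?_
  rcases (by omega : a = 0 ∨ a = 1) with rfl | rfl
  · exact ⟨pattern d (2 * h) 1, pattern d (2 * h) 1, key 0 1 hle⟩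
  · exact ⟨pattern d (2 * h) 0, pattern d (2 * h) 0, key 1 0 hle'⟩

/-- It suffices to check an event for typical strings in which the block is filled with a fixed
letter. -/
theorem LongBlockModel.one_sub_wordProb_le (M : LongBlockModel P 2 d (2 * h) X Xs Y) (hd : 1 ≤ d)
    (hh1 : 1 ≤ h) {s : ℝ} {E : Set Ω}
    (hE : ∀ ω a, (∀ i ∈ block d (2 * h), X i ω = a) →
      (∀ i, i ∉ block d (2 * h) → Xs i ω = X i ω) →
      Typical d h s (List.ofFn fun i => Xs i ω) (List.ofFn fun i => Y i ω) → ω ∈ E) :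
    1 - wordProb (2 * d) (2 * d) (fun x y => ¬ Typical d h s x y) ≤ P.real E := by
  obtain ⟨i₀, hi₀⟩ := block_nonempty (d := d) (h := h) hd hh1
  refine one_sub_le_real (le_trans ?_ (M.real_le_wordProb _))
  refine real_mono_ae ?_
  filter_upwards [M.const, M.agree] with ω hc hag hω hT
  exact hω (hE ω _ (fun i hi => hc i hi i₀ hi₀) hag hT)

end Events

end

theorem theorem2 (α β : ℝ) (hα : 1 / 2 < α) (hαβ : α < β) (hβ : β < 1)
    (hk : 2 * gammaStar 2 < 2)
    (hdiff : DifferentiableAt ℝ (gammaFun 2) (pMax 2)) :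
    (∃ CG : ℝ, 0 < CG ∧ ∀ d : ℕ, 1 ≤ d →
      ∀ (Ω : Type*) [MeasurableSpace Ω] (P : Measure Ω) [IsProbabilityMeasure P]
        (X Xs Y : Fin (2 * d) → Ω → Fin 2), LongBlockModel P 2 d (blockLen β d) X Xs Y →
        1 - Real.exp (-CG * (d : ℝ) ^ (2 * α - 1)) ≤ P.real (eventGaps α (blockLen β d) X Y) ∧
        1 - Real.exp (-CG * (d : ℝ) ^ (2 * α - 1)) ≤ P.real (eventG α (blockLen β d) X Y)) ∧
    (∀ c : ℝ, 0 < c → c < 3 * gammaStar 2 / 2 - 1 →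
      ∃ CH : ℝ, 0 < CH ∧ ∀ d : ℕ, 1 ≤ d →
      ∀ (Ω : Type*) [MeasurableSpace Ω] (P : Measure Ω) [IsProbabilityMeasure P]
        (X Xs Y : Fin (2 * d) → Ω → Fin 2), LongBlockModel P 2 d (blockLen β d) X Xs Y →
        1 - Real.exp (-CH * (d : ℝ) ^ (2 * α - 1)) ≤ P.real (eventH β c X Xs Y)) := by
  have hγ : gammaStar 2 < 1 := by linarith
  have hτ : 2 * α - 1 ≤ 1 := by linarith
  constructor
  · set κ := (1 - gammaStar 2) / 16 with hκ
    have hκ0 : 0 < κ := by rw [hκ]; linarith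
    obtain ⟨d₀, hd₀⟩ := eventually_atTop.1
      ((eventually_wordProb_not_typical_le (α := α) hα hβ.le hκ0).and
        (eventually_lcs_fillBlock_lt hα hαβ hβ hγ hdiff))
    obtain ⟨C, hC, hCd⟩ := exists_forall_one_sub_exp_le (c := κ ^ 2 / 4) (by positivity) hτ d₀
    refine ⟨C, hC, fun d hd Ω _ P _ X Xs Y M => ?_⟩
    rw [blockLen_eq] at M ⊢
    have hh := halfBlock_le hβ.le hd
    have hG : 1 - Real.exp (-C * (d : ℝ) ^ (2 * α - 1)) ≤
        P.real (eventG α (2 * halfBlock β d) X Y) := by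
      refine hCd d hd _ (fun hle => ?_)
        (M.le_real_eventG hd hh (one_le_halfBlock β d) (by linarith))
      obtain ⟨h1, hm, h2⟩ := hd₀ d hle
      refine le_trans (by linarith) (M.one_sub_wordProb_le hd (one_le_halfBlock β d)
        (s := κ * (d : ℝ) ^ α) fun ω a hb ho hT => ?_)
      simp only [eventG, Set.mem_ofPred_eq, lcsFn]
      rw [cutBlock_eq_fillBlock hh hm hb ho, ofFn_eq_fillBlock hh hb ho]
      exact h2 _ _ List.length_ofFn hT a
    exact ⟨hG.trans (M.real_eventG_le hh α), hG⟩
  · intro c hc0 hc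
    obtain ⟨d₀, hd₀⟩ := eventually_atTop.1
      ((eventually_wordProb_not_typical_le (α := α) (κ := 1) hα hβ.le one_pos).and
        (eventually_le_lcs_sub hα hαβ hβ hγ hc0 hc))
    obtain ⟨C, hC, hCd⟩ := exists_forall_one_sub_exp_le (c := 1 ^ 2 / 4) (by norm_num) hτ d₀
    refine ⟨C, hC, fun d hd Ω _ P _ X Xs Y M => ?_⟩
    rw [blockLen_eq] at M
    have hh := halfBlock_le hβ.le hd
    have hpow : 0 ≤ (d : ℝ) ^ β := by positivity
    -- `c < 1 / 2`, and the block has at least `max 2 (d ^ β - 1)` letters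
    have hsmall : c * (d : ℝ) ^ β ≤ 2 * halfBlock β d := by
      have h1 := le_two_mul_halfBlock β d
      have h2 : (1 : ℝ) ≤ halfBlock β d := by exact_mod_cast one_le_halfBlock β d
      have h3 : c ≤ 1 / 2 := by linarith
      have h4 := mul_le_mul_of_nonneg_right h3 hpow
      linarith
    refine hCd d hd _ (fun hle => ?_) (M.le_real_eventH hd hh (one_le_halfBlock β d) hsmall)
    obtain ⟨h1, h2⟩ := hd₀ d hle
    refine le_trans (by linarith) (M.one_sub_wordProb_le hd (one_le_halfBlock β d)
      (s := 1 * (d : ℝ) ^ α) fun ω a hb ho hT => ?_)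
    simp only [eventH, Set.mem_ofPred_eq, lcsFn]
    rw [ofFn_eq_fillBlock hh hb ho]
    exact h2 _ _ List.length_ofFn hT a
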